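/- Let $n \ge 0$ and let $\gamma : \mathbb{C}^n \to \mathbb{C}^n$ be an invertible holomorphic contraction centered in $0$, that is, a biholomorphic map with $\gamma(0)=0$ such that for every compact $K \subset \mathbb{C}^n$ and every open $U \ni 0$ one has $\gamma^k(K) \subset U$ for all sufficiently large $k$. Let $H = (\mathbb{C}^n\setminus 0)/\langle\gamma\rangle$ be the corresponding Hopf manifold, a complex manifold whose charts are the local inverses of the covering map $\mathbb{C}^n\setminus 0 \to H$. Suppose that the tangent bundle $TH$ admits a smooth connection $\nabla$ which is flat ($\nabla_X\nabla_YZ-\nabla_Y\nabla_XZ-\nabla_{[X,Y]}Z=0$), torsion-free ($\nabla_XY-\nabla_YX=[X,Y]$) and compatible with the holomorphic structure ($\nabla$ is complex linear, and its Hodge component $\nabla^{0,1}$ is the holomorphic structure operator $\bar\partial$ of $TH$). Then $H$ is isomorphic to a linear Hopf manifold: there is $A \in \mathrm{GL}(n,\mathbb{C})$ such that $z \mapsto Az$ is a contraction of $\mathbb{C}^n$ centered in $0$ and $H$ is biholomorphic to $(\mathbb{C}^n\setminus 0)/\langle A\rangle$. -/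

import Mathlib

open Set Topology Bundle
open scoped Manifold ContDiff

/-! ### Holomorphic contractions -/

/-- A continuous map `f : M → M` fixing `x` is a contraction centered in `x` if for every compact
set `K` and every open set `U` containing `x`, all sufficiently high powers of `f` take `K`
to `U`. -/
structure IsContractionCenteredAt {M : Type*} [TopologicalSpace M] (f : M → M) (x : M) : Prop where
  continuous : Continuous f
  apply_eq : f x = x
  eventually_image_subset : ∀ K : Set M, IsCompact K → ∀ U : Set M, IsOpen U → x ∈ U →
    ∃ N : ℕ, ∀ k ≥ N, f^[k] '' K ⊆ U

/-- An invertible holomorphic contraction of `ℂⁿ` centered in `0`: a biholomorphic map of `ℂⁿ` to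
itself which is a contraction centered in `0`. Holomorphic maps are the complex analytic ones
(`ContDiff ℂ ω`). -/
structure HolomorphicContraction (n : ℕ) extends (Fin n → ℂ) ≃ (Fin n → ℂ) where
  contDiff_toFun : ContDiff ℂ ω toFun
  contDiff_invFun : ContDiff ℂ ω invFun
  isContraction : IsContractionCenteredAt toFun 0

/-- The complex manifold `ℂⁿ ∖ 0`. -/
abbrev PuncturedSpace (n : ℕ) : Type := {z : Fin n → ℂ // z ≠ 0}

namespace HolomorphicContraction

variable {n : ℕ} (γ : HolomorphicContraction n)

theorem ne_zero_iff (z : Fin n → ℂ) : z ≠ 0 ↔ γ.toEquiv z ≠ 0 := by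
  have h0 : γ.toEquiv 0 = 0 := γ.isContraction.apply_eq
  rw [not_iff_not]
  constructor
  · rintro rfl
    exact h0
  · intro h
    exact γ.toEquiv.injective (h.trans h0.symm)

/-- The restriction of `γ` to `ℂⁿ ∖ 0`. -/
def punctured : Equiv.Perm (PuncturedSpace n) :=
  γ.toEquiv.subtypeEquiv γ.ne_zero_iff

/-- The group `⟨γ⟩` of transformations of `ℂⁿ ∖ 0` generated by `γ`. -/
abbrev deckGroup : Subgroup (Equiv.Perm (PuncturedSpace n)) :=
  Subgroup.zpowers γ.punctured

theorem zpow_val_contDiff (k : ℤ) :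
    ∃ F : (Fin n → ℂ) → (Fin n → ℂ), ContDiff ℂ ω F ∧
      ∀ z : PuncturedSpace n, ((γ.punctured ^ k) z : Fin n → ℂ) = F z := by
  have aux (f : Equiv.Perm (PuncturedSpace n)) (F : (Fin n → ℂ) → (Fin n → ℂ))
      (hF : ContDiff ℂ ω F) (h : ∀ z, (f z : Fin n → ℂ) = F z) (k : ℕ) :
      ∃ F : (Fin n → ℂ) → (Fin n → ℂ), ContDiff ℂ ω F ∧
        ∀ z : PuncturedSpace n, ((f ^ k) z : Fin n → ℂ) = F z := by
    induction k with
    | zero => exact ⟨id, contDiff_id, fun z => rfl⟩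
    | succ k ih =>
      obtain ⟨G, hG, hGz⟩ := ih
      refine ⟨G ∘ F, hG.comp hF, fun z => ?_⟩
      rw [pow_succ, Equiv.Perm.mul_apply, hGz, h]
      rfl
  obtain ⟨k, rfl | rfl⟩ := k.eq_nat_or_neg
  · simpa using aux γ.punctured _ γ.contDiff_toFun (fun z => rfl) k
  · have := aux γ.punctured⁻¹ _ γ.contDiff_invFun (fun z => rfl) k
    simpa [inv_pow] using this

theorem pow_val (k : ℕ) (z : PuncturedSpace n) :
    ((γ.punctured ^ k) z : Fin n → ℂ) = γ.toFun^[k] z := by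
  induction k generalizing z with
  | zero => rfl
  | succ k ih =>
    rw [pow_succ, Equiv.Perm.mul_apply, ih, Function.iterate_succ_apply]
    rfl

instance : ContinuousConstSMul γ.deckGroup (PuncturedSpace n) where
  continuous_const_smul := by
    rintro ⟨g, k, rfl⟩
    obtain ⟨F, hF, h⟩ := γ.zpow_val_contDiff k
    have hc : Continuous fun z : PuncturedSpace n => F z :=
      hF.continuous.comp continuous_subtype_val
    exact continuous_induced_rng.2 (hc.congr fun z => (h z).symm)

theorem exists_pow_disjoint {K : Set (PuncturedSpace n)} (hK : IsCompact K) :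
    ∃ N : ℕ, ∀ k ≥ N, ∀ z ∈ K, (γ.punctured ^ k) z ∉ K := by
  have hK' : IsCompact (Subtype.val '' K) := hK.image continuous_subtype_val
  obtain ⟨N, hN⟩ := γ.isContraction.eventually_image_subset _ hK' _ hK'.isClosed.isOpen_compl
    (by rintro ⟨z, -, hz⟩; exact z.2 hz)
  refine ⟨N, fun k hk z hz hmem => ?_⟩
  exact hN k hk ⟨z, ⟨z, hz, rfl⟩, rfl⟩ ⟨_, hmem, γ.pow_val k z⟩

instance : ProperlyDiscontinuousSMul γ.deckGroup (PuncturedSpace n) where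
  finite_disjoint_inter_image := by
    intro K L hK hL
    obtain ⟨N, hN⟩ := γ.exists_pow_disjoint (hK.union hL)
    refine ((Set.finite_Icc (-(N : ℤ)) N).image
      (fun k : ℤ => (⟨γ.punctured ^ k, k, rfl⟩ : γ.deckGroup))).subset ?_
    rintro ⟨g, k, rfl⟩ ⟨_, ⟨z, hz, rfl⟩, hzL⟩
    refine ⟨k, ?_, rfl⟩
    have hzL' : (γ.punctured ^ k) z ∈ L := hzL
    by_contra hk
    rw [Set.mem_Icc, not_and_or, not_le, not_le] at hk
    rcases hk with hk | hk
    · obtain ⟨m, rfl⟩ : ∃ m : ℕ, k = -(m : ℤ) := ⟨(-k).toNat, by omega⟩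
      refine hN m (by omega) _ (Or.inr hzL') (Or.inl ?_)
      simpa using hz
    · obtain ⟨m, rfl⟩ : ∃ m : ℕ, k = (m : ℤ) := ⟨k.toNat, by omega⟩
      exact hN m (by omega) _ (Or.inl hz) (Or.inr (by simpa using hzL'))

instance : IsCancelSMul γ.deckGroup (PuncturedSpace n) := by
  rw [isCancelSMul_iff_eq_one_of_smul_eq]
  have key (m : ℕ) (hm : 0 < m) (z : PuncturedSpace n) : (γ.punctured ^ m) z ≠ z := by
    intro h
    obtain ⟨N, hN⟩ := γ.exists_pow_disjoint (isCompact_singleton (x := z))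
    have hfix : (γ.punctured ^ (m * N)) z = z := by
      rw [pow_mul, ← Equiv.Perm.iterate_eq_pow]
      exact Function.iterate_fixed h N
    exact hN (m * N) (Nat.le_mul_of_pos_left N hm) z rfl hfix
  rintro ⟨g, k, rfl⟩ z hz
  have hz' : (γ.punctured ^ k) z = z := hz
  obtain ⟨m, rfl | rfl⟩ := k.eq_nat_or_neg
  · rcases Nat.eq_zero_or_pos m with rfl | hm
    · ext; simp
    · exact absurd (by simpa using hz') (key m hm z)
  · rcases Nat.eq_zero_or_pos m with rfl | hm
    · ext; simp
    · refine absurd ?_ (key m hm z)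
      rw [zpow_neg, Equiv.Perm.inv_eq_iff_eq] at hz'
      simpa using hz'.symm

end HolomorphicContraction

/-! ### Hopf manifolds -/

/-- The Hopf manifold `(ℂⁿ ∖ 0) / ⟨γ⟩`, with the quotient topology. -/
def HopfManifold {n : ℕ} (γ : HolomorphicContraction n) : Type :=
  MulAction.orbitRel.Quotient γ.deckGroup (PuncturedSpace n)

namespace HopfManifold

variable {n : ℕ} (γ : HolomorphicContraction n)

instance : TopologicalSpace (HopfManifold γ) :=
  inferInstanceAs (TopologicalSpace (MulAction.orbitRel.Quotient γ.deckGroup (PuncturedSpace n)))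

/-- The covering map `ℂⁿ ∖ 0 → (ℂⁿ ∖ 0) / ⟨γ⟩`. -/
def proj (z : PuncturedSpace n) : HopfManifold γ :=
  Quotient.mk (MulAction.orbitRel γ.deckGroup (PuncturedSpace n)) z

instance : LocallyCompactSpace (PuncturedSpace n) :=
  (isOpen_ne (x := (0 : Fin n → ℂ))).locallyCompactSpace

theorem isQuotientCoveringMap_proj : IsQuotientCoveringMap (proj γ) γ.deckGroup :=
  isQuotientCoveringMap_quotientMk_of_properlyDiscontinuousSMul

theorem proj_eq_iff {z w : PuncturedSpace n} :
    proj γ z = proj γ w ↔ ∃ k : ℤ, (γ.punctured ^ k) w = z := by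
  rw [(isQuotientCoveringMap_proj γ).apply_eq_iff_mem_orbit]
  constructor
  · rintro ⟨⟨g, k, rfl⟩, h⟩
    exact ⟨k, h⟩
  · rintro ⟨k, h⟩
    exact ⟨⟨_, k, rfl⟩, h⟩

instance : T2Space (HopfManifold γ) :=
  inferInstanceAs (T2Space (Quotient (MulAction.orbitRel γ.deckGroup (PuncturedSpace n))))

/-- The atlas of the Hopf manifold: its charts are the local inverses of the covering map
`ℂⁿ ∖ 0 → (ℂⁿ ∖ 0) / ⟨γ⟩`. -/
def charts : Set (OpenPartialHomeomorph (HopfManifold γ) (Fin n → ℂ)) :=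
  {φ | ∀ h ∈ φ.source, ∃ hz : φ h ≠ 0, proj γ ⟨φ h, hz⟩ = h}

theorem exists_chart (h : HopfManifold γ) : ∃ φ ∈ charts γ, h ∈ φ.source := by
  obtain ⟨z, rfl⟩ := (isQuotientCoveringMap_proj γ).surjective h
  obtain ⟨e, hze, he⟩ := (isQuotientCoveringMap_proj γ).isCoveringMap.isLocalHomeomorph z
  have : Nonempty (PuncturedSpace n) := ⟨z⟩
  have ho : IsOpenEmbedding (Subtype.val : PuncturedSpace n → (Fin n → ℂ)) :=
    (isOpen_ne (x := (0 : Fin n → ℂ))).isOpenEmbedding_subtypeVal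
  refine ⟨e.symm.trans ho.toOpenPartialHomeomorph, ?_, ?_⟩
  · intro h hh
    have hh' : h ∈ e.target := by simpa using hh
    refine ⟨(e.symm h).2, ?_⟩
    change proj γ (e.symm h) = h
    rw [he]
    exact e.right_inv hh'
  · rw [he]
    simpa using e.map_source hze

noncomputable instance : ChartedSpace (Fin n → ℂ) (HopfManifold γ) where
  atlas := charts γ
  chartAt h := (exists_chart γ h).choose
  mem_chart_source h := (exists_chart γ h).choose_spec.2
  chart_mem_atlas h := (exists_chart γ h).choose_spec.1

theorem contDiffOn_transition {φ ψ : OpenPartialHomeomorph (HopfManifold γ) (Fin n → ℂ)}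
    (hφ : φ ∈ charts γ) (hψ : ψ ∈ charts γ) :
    ContDiffOn ℂ ω (φ.symm.trans ψ) (φ.symm.trans ψ).source := by
  intro a ha
  have ha1 : a ∈ φ.target := by
    have := ha.1
    simpa using this
  have ha2 : φ.symm a ∈ ψ.source := ha.2
  -- over the overlap, a chart value determines its class
  have hcls : ∀ b (hb : b ∈ φ.target), ∃ hz : b ≠ 0, proj γ ⟨b, hz⟩ = φ.symm b := by
    intro b hb
    obtain ⟨hz, h⟩ := hφ _ (φ.map_target hb)
    have hb' : φ (φ.symm b) = b := φ.right_inv hb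
    have hb0 : b ≠ 0 := fun h0 => hz (hb'.trans h0)
    refine ⟨hb0, Eq.trans ?_ h⟩
    exact congrArg (proj γ) (Subtype.ext hb'.symm)
  obtain ⟨ha0, hpa⟩ := hcls a ha1
  obtain ⟨hb0, hpb⟩ := hψ _ ha2
  obtain ⟨k, hk⟩ := (proj_eq_iff γ).1 (hpb.trans hpa.symm)
  obtain ⟨F, hF, hFz⟩ := γ.zpow_val_contDiff k
  have hFa : F a = ψ (φ.symm a) := by
    rw [← hFz ⟨a, ha0⟩, hk]
  have hFa' : F a ∈ ψ.target := hFa ▸ ψ.map_source ha2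
  have hev : ∀ᶠ b in 𝓝 a, (φ.symm.trans ψ) b = F b := by
    filter_upwards [hF.continuous.continuousAt.preimage_mem_nhds (ψ.open_target.mem_nhds hFa'),
      (φ.symm.trans ψ).open_source.mem_nhds ha] with b hb1 hb2
    have hb3 : b ∈ φ.target := by
      have := hb2.1
      simpa using this
    obtain ⟨hb0, hpb⟩ := hcls b hb3
    obtain ⟨hc0, hpc⟩ := hψ _ (ψ.map_target hb1)
    have hc : ψ (ψ.symm (F b)) = F b := ψ.right_inv hb1
    have h1 : proj γ ⟨b, hb0⟩ = ψ.symm (F b) := by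
      rw [← hpc]
      refine ((proj_eq_iff γ).2 ⟨k, Subtype.ext ?_⟩).symm
      rw [hFz]
      exact hc.symm
    change ψ (φ.symm b) = F b
    rw [← hpb, h1, hc]
  exact (hF.contDiffAt.congr_of_eventuallyEq hev).contDiffWithinAt

/-- The Hopf manifold is a complex manifold. -/
instance : IsManifold 𝓘(ℂ, Fin n → ℂ) ω (HopfManifold γ) :=
  isManifold_of_contDiffOn _ _ _ fun φ ψ hφ hψ => by
    have h := contDiffOn_transition γ hφ hψ
    simpa using h

/-- The underlying real manifold of the Hopf manifold. -/
instance : IsManifold 𝓘(ℝ, Fin n → ℂ) ω (HopfManifold γ) :=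
  isManifold_of_contDiffOn _ _ _ fun φ ψ hφ hψ => by
    have h := (contDiffOn_transition γ hφ hψ).restrict_scalars ℝ
    simpa using h

end HopfManifold

/-! ### Connections on the tangent bundle of a complex manifold -/

section Connections

variable {n : ℕ} {M : Type*} [TopologicalSpace M] [ChartedSpace (Fin n → ℂ) M]

/-- The complex structure operator `J` (multiplication by `√-1`) on the tangent space of a complex
manifold, considered as a real vector space. Tangent vectors are given by their coordinates in the
preferred holomorphic chart at `x`. -/
noncomputable def tangentJ (x : M) :
    TangentSpace 𝓘(ℝ, Fin n → ℂ) x →L[ℝ] TangentSpace 𝓘(ℝ, Fin n → ℂ) x :=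
  (Complex.I • ContinuousLinearMap.id ℝ (Fin n → ℂ) : (Fin n → ℂ) →L[ℝ] (Fin n → ℂ))

/-- `X` is a smooth (real) vector field over the open set `U`. -/
def IsSmoothVectorFieldOn [IsManifold 𝓘(ℝ, Fin n → ℂ) ω M]
    (X : Π x : M, TangentSpace 𝓘(ℝ, Fin n → ℂ) x) (U : Set M) : Prop :=
  ContMDiffOn 𝓘(ℝ, Fin n → ℂ) (𝓘(ℝ, Fin n → ℂ).prod 𝓘(ℝ, Fin n → ℂ)) ∞
    (fun x => (⟨x, X x⟩ :
      TotalSpace (Fin n → ℂ) (fun y : M => TangentSpace 𝓘(ℝ, Fin n → ℂ) y))) U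

/-- A vector field on `M`, considered as a section of the holomorphic tangent bundle (whose fibres
are the tangent spaces with their complex structure). -/
def toHolomorphicTangent (σ : Π x : M, TangentSpace 𝓘(ℝ, Fin n → ℂ) x) :
    Π x : M, TangentSpace 𝓘(ℂ, Fin n → ℂ) x :=
  σ

/-- `σ` is a holomorphic section of the holomorphic tangent bundle over the open set `U`. -/
def IsHolomorphicVectorFieldOn [IsManifold 𝓘(ℂ, Fin n → ℂ) ω M]
    (σ : Π x : M, TangentSpace 𝓘(ℝ, Fin n → ℂ) x) (U : Set M) : Prop :=
  ContMDiffOn 𝓘(ℂ, Fin n → ℂ) (𝓘(ℂ, Fin n → ℂ).prod 𝓘(ℂ, Fin n → ℂ)) ω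
    (fun x => (⟨x, toHolomorphicTangent σ x⟩ :
      TotalSpace (Fin n → ℂ) (fun y : M => TangentSpace 𝓘(ℂ, Fin n → ℂ) y))) U

/-- A connection `∇` on `TM` is flat if its curvature
`R(X, Y) Z = ∇_X ∇_Y Z - ∇_Y ∇_X Z - ∇_[X, Y] Z` vanishes, for all (local) smooth vector fields.
Here `∇_X Z` at `x` is `nabla Z x (X x)`. -/
def CovariantDerivative.IsFlat [IsManifold 𝓘(ℝ, Fin n → ℂ) ω M]
    (nabla : CovariantDerivative 𝓘(ℝ, Fin n → ℂ) (Fin n → ℂ)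
      (fun x : M => TangentSpace 𝓘(ℝ, Fin n → ℂ) x)) : Prop :=
  ∀ U : Set M, IsOpen U → ∀ X Y Z : Π x : M, TangentSpace 𝓘(ℝ, Fin n → ℂ) x,
    IsSmoothVectorFieldOn X U → IsSmoothVectorFieldOn Y U → IsSmoothVectorFieldOn Z U → ∀ x ∈ U,
      nabla (fun y => nabla Z y (Y y)) x (X x) - nabla (fun y => nabla Z y (X y)) x (Y x)
        - nabla Z x (VectorField.mlieBracket 𝓘(ℝ, Fin n → ℂ) X Y x) = 0

/-- A connection `∇` on `TM` is compatible with the holomorphic structure if it is a connection on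
the complex vector bundle `TM`, that is, complex linear, and its Hodge component `∇^{0,1}` is the
holomorphic structure operator of `TM`. By the Leibniz rule, the latter means that `∇^{0,1}`
vanishes on local holomorphic sections, i.e. the `TM`-valued one-form `∇ σ` is complex linear for
every local holomorphic section `σ`. -/
structure CovariantDerivative.IsCompatibleWithHolomorphicStructure
    [IsManifold 𝓘(ℂ, Fin n → ℂ) ω M] [IsManifold 𝓘(ℝ, Fin n → ℂ) ω M]
    (nabla : CovariantDerivative 𝓘(ℝ, Fin n → ℂ) (Fin n → ℂ)
      (fun x : M => TangentSpace 𝓘(ℝ, Fin n → ℂ) x)) : Prop where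
  complex_linear : ∀ U : Set M, IsOpen U → ∀ σ : Π x : M, TangentSpace 𝓘(ℝ, Fin n → ℂ) x,
    IsSmoothVectorFieldOn σ U → ∀ x ∈ U, ∀ v : TangentSpace 𝓘(ℝ, Fin n → ℂ) x,
      nabla (fun y => tangentJ y (σ y)) x v = tangentJ x (nabla σ x v)
  dbar_eq : ∀ U : Set M, IsOpen U → ∀ σ : Π x : M, TangentSpace 𝓘(ℝ, Fin n → ℂ) x,
    IsHolomorphicVectorFieldOn σ U → ∀ x ∈ U, ∀ v : TangentSpace 𝓘(ℝ, Fin n → ℂ) x,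
      nabla σ x (tangentJ x v) = tangentJ x (nabla σ x v)

end Connections

/-! For `n ≥ 2` the connection is pulled back to `ℂⁿ ∖ 0` and written as `d + Γ` in the standard
coordinates. Complex linearity of `∇`, together with the symmetry of `Γ` coming from vanishing
torsion, makes `Γ` complex bilinear. Flatness then expresses the derivative of `Γ` in a direction
`u` through terms that are complex linear in `u`, so `Γ` is holomorphic
(`fderiv_christoffel_I_smul`). Since the connection comes from the quotient, `Γ` obeys the
transformation law under `γ`. By Hartogs `Γ` extends to an entire function, and symmetry, flatness
and invariance persist at the origin by continuity (`exists_entire_christoffel_symbols`).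

The extended connection is flat near `0`, hence has a parallel coframe `G` with `G 0 = 1`
(`exists_parallel_of_flat`). Symmetry of `Γ` makes the one-form `G` closed, so `G = dF` with `F 0 =
0`: the map `F` is a system of flat coordinates. Let `A = dγ₀`. As `γ` preserves the connection,
`A⁻¹ γ^*G` is again parallel with value `1` at the origin, hence equals `G`. Therefore `F ∘ γ = A ∘
F` near `0` (`exists_local_linearization`).

The dynamics makes this germ global: `A⁻ᵐ ∘ F ∘ γᵐ` does not depend on `m` once the orbit is close
to `0`, and it defines a biholomorphism of `ℂⁿ` conjugating `γ` to `A`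
(`exists_global_linearization`). It descends to the Hopf manifolds.

For `n ≤ 1` the map `γ` is itself linear, since an entire automorphism of `ℂ` fixing `0` is
multiplication by a constant (`exists_eq_mul_of_entire_equiv`).

The analytic groundwork is Cauchy's formula on polydiscs. It yields analyticity of holomorphic maps
in several variables, convergence of the Picard series to a holomorphic frame, and the Hartogs
extension. -/

/-! ### Cauchy's formula on polydiscs and Osgood's lemma -/

theorem continuous_torusMap {n : ℕ} (c : Fin n → ℂ) (R : Fin n → ℝ) :
    Continuous (torusMap c R) := by
  unfold torusMap; fun_prop

theorem torusMap_sub_ne_zero {n : ℕ} {c z : Fin n → ℂ} {R : ℝ} (hz : z ∈ Metric.ball c R)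
    (θ : Fin n → ℝ) (i : Fin n) : torusMap c (fun _ => R) θ i - z i ≠ 0 := by
  intro h0
  have hR : 0 ≤ R := (Metric.pos_of_mem_ball hz).le
  have h2 : dist (z i) (c i) < R := (dist_le_pi_dist z c i).trans_lt hz
  rw [← sub_eq_zero.1 h0, dist_eq_norm] at h2
  simp [torusMap, Complex.norm_exp, abs_of_nonneg hR] at h2

-- The kernel, seen as a function on the torus, is an element of the Banach algebra `C(K, ℂ)`
-- depending analytically on `z`, because inversion in a Banach algebra is analytic. Integration
-- against `f` is a continuous linear map on that algebra, so analyticity survives without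
-- differentiating under the integral.
open MeasureTheory in
theorem contDiffOn_torusIntegral_kernel {n : ℕ} {E : Type*} [NormedAddCommGroup E]
    [NormedSpace ℂ E] {c : Fin n → ℂ} {R : ℝ} {f : (Fin n → ℂ) → E}
    (hf : Continuous fun θ => f (torusMap c (fun _ => R) θ)) :
    ContDiffOn ℂ ω (fun z => torusIntegral (fun x => (∏ i, (x i - z i)⁻¹) • f x) c (fun _ => R))
      (Metric.ball c R) := by
  set K : Set (Fin n → ℝ) := Icc 0 fun _ => 2 * Real.pi with hK
  have : CompactSpace K := isCompact_iff_compactSpace.1 isCompact_Icc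
  set μ : Measure K := Measure.comap Subtype.val volume with hμ
  have : IsFiniteMeasure μ := by
    refine ⟨?_⟩
    rw [hμ, comap_subtype_coe_apply measurableSet_Icc, image_univ, Subtype.range_coe]
    exact isCompact_Icc.measure_lt_top
  -- The factor in front of `f` is the Jacobian of the torus parametrization.
  set g : (Fin n → ℝ) → E := fun θ =>
    (∏ i, (R : ℂ) * Complex.exp (θ i * Complex.I) * Complex.I : ℂ) • f (torusMap c (fun _ => R) θ)
    with hg
  have hgc : Continuous g := by
    refine Continuous.smul ?_ hf
    fun_prop
  have hint (h : C(K, ℂ)) : Integrable (fun θ : K => h θ • g θ) μ := by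
    refine Continuous.integrable_of_hasCompactSupport ?_ (HasCompactSupport.of_compactSpace _)
    exact h.continuous.smul (hgc.comp continuous_subtype_val)
  have hgint : Integrable (fun θ : K => g θ) μ :=
    Continuous.integrable_of_hasCompactSupport (hgc.comp continuous_subtype_val)
      (HasCompactSupport.of_compactSpace _)
  let L₀ : C(K, ℂ) →ₗ[ℂ] E :=
    { toFun := fun h => ∫ θ, h θ • g θ ∂μ
      map_add' := fun h k => by
        simp only [ContinuousMap.add_apply, add_smul]
        exact integral_add (hint h) (hint k)
      map_smul' := fun a h => by
        simp only [ContinuousMap.smul_apply, smul_eq_mul, mul_smul, RingHom.id_apply]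
        exact integral_smul a _ }
  let L : C(K, ℂ) →L[ℂ] E := L₀.mkContinuous (∫ θ, ‖g θ‖ ∂μ) (fun h => by
    rw [mul_comm, ← integral_const_mul]
    refine norm_integral_le_of_norm_le (hgint.norm.const_mul _) (Filter.Eventually.of_forall ?_)
    intro θ
    rw [norm_smul]
    gcongr
    exact h.norm_coe_le_norm θ)
  let ζ (i : Fin n) : C(K, ℂ) := ⟨fun θ => torusMap c (fun _ => R) θ i, by
    exact (continuous_apply i).comp
      ((continuous_torusMap c fun _ => R).comp continuous_subtype_val)⟩
  let H (z : Fin n → ℂ) : C(K, ℂ) := ∏ i, Ring.inverse (ζ i - algebraMap ℂ C(K, ℂ) (z i))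
  have hne {z : Fin n → ℂ} (hz : z ∈ Metric.ball c R) (i : Fin n) (θ : K) :
      (ζ i - algebraMap ℂ C(K, ℂ) (z i)) θ ≠ 0 := by
    simpa [ζ] using torusMap_sub_ne_zero hz θ i
  have hunit {z : Fin n → ℂ} (hz : z ∈ Metric.ball c R) (i : Fin n) :
      IsUnit (ζ i - algebraMap ℂ C(K, ℂ) (z i)) :=
    (ContinuousMap.isUnit_iff_forall_ne_zero _).2 (hne hz i)
  have hH : ContDiffOn ℂ ω H (Metric.ball c R) := by
    intro z hz
    refine ContDiffAt.contDiffWithinAt ?_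
    refine contDiffAt_prod fun i _ => ?_
    obtain ⟨u, hu⟩ := hunit hz i
    refine ContDiffAt.comp z (g := Ring.inverse) ?_ ?_
    · rw [← hu]; exact contDiffAt_ringInverse ℂ u
    · refine contDiffAt_const.sub ?_
      exact ((Algebra.linearMap ℂ C(K, ℂ)).toContinuousLinearMap.contDiff.comp
        (contDiff_apply ℂ ℂ i)).contDiffAt
  have hHapp {z : Fin n → ℂ} (hz : z ∈ Metric.ball c R) (θ : K) :
      H z θ = ∏ i, (torusMap c (fun _ => R) θ i - z i)⁻¹ := by
    simp only [H, ContinuousMap.coe_prod, Finset.prod_apply]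
    refine Finset.prod_congr rfl fun i _ => ?_
    have h1 := congrArg (fun h : C(K, ℂ) => h θ) (Ring.mul_inverse_cancel _ (hunit hz i))
    have h2 := hne hz i θ
    simp only [ContinuousMap.mul_apply, ContinuousMap.one_apply] at h1
    rw [eq_inv_of_mul_eq_one_right h1]
    rfl
  refine (L.contDiff.comp_contDiffOn hH).congr fun z hz => ?_
  change _ = ∫ θ, H z θ • g θ ∂μ
  unfold torusIntegral
  rw [← integral_subtype_comap measurableSet_Icc]
  refine integral_congr_ae (Filter.Eventually.of_forall fun θ => ?_)
  simp only [hHapp hz, hg]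
  rw [smul_comm]

theorem differentiableAt_slice_cons_succ {n : ℕ} {E : Type*} [NormedAddCommGroup E]
    [NormedSpace ℂ E] {f : (Fin (n + 1) → ℂ) → E} {x : ℂ} {y : Fin n → ℂ} {i : Fin n}
    (h : DifferentiableAt ℂ
      (fun t => f (Function.update (Fin.cons x y : Fin (n + 1) → ℂ) i.succ t))
      ((Fin.cons x y : Fin (n + 1) → ℂ) i.succ)) :
    DifferentiableAt ℂ (fun t => f (Fin.cons x (Function.update y i t))) (y i) := by
  simpa [Fin.cons_update] using h

theorem cons_mem_closedBall {n : ℕ} {c : Fin (n + 1) → ℂ} {R : ℝ} (hR : 0 ≤ R) {x : ℂ}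
    {y : Fin n → ℂ} :
    (Fin.cons x y : Fin (n + 1) → ℂ) ∈ Metric.closedBall c R ↔
      x ∈ Metric.closedBall (c 0) R ∧ y ∈ Metric.closedBall (c ∘ Fin.succ) R := by
  simp [Metric.mem_closedBall, dist_pi_le_iff hR, Fin.forall_fin_succ]

theorem torusMap_mem_closedBall {n : ℕ} (c : Fin n → ℂ) {R : ℝ} (hR : 0 ≤ R) (θ : Fin n → ℝ) :
    torusMap c (fun _ => R) θ ∈ Metric.closedBall c R := by
  rw [Metric.mem_closedBall, dist_pi_le_iff hR]
  intro i
  simp [torusMap, dist_eq_norm, Complex.norm_exp, abs_of_nonneg hR]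

theorem torusIntegrable_kernel {n : ℕ} {E : Type*} [NormedAddCommGroup E]
    [NormedSpace ℂ E] {c z : Fin n → ℂ} {R : ℝ} {f : (Fin n → ℂ) → E}
    (hz : z ∈ Metric.ball c R) (hf : Continuous fun θ => f (torusMap c (fun _ => R) θ)) :
    TorusIntegrable (fun x => (∏ i, (x i - z i)⁻¹) • f x) c (fun _ => R) := by
  unfold TorusIntegrable
  refine ContinuousOn.integrableOn_compact isCompact_Icc ?_
  refine Continuous.continuousOn (Continuous.smul ?_ hf)
  refine continuous_finsetProd _ fun i _ => Continuous.inv₀ ?_ fun θ => torusMap_sub_ne_zero hz θ i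
  have h := (continuous_apply i).comp (continuous_torusMap c fun _ => R)
  exact h.sub (continuous_const (y := z i))

/-- The kernel integral over the torus of dimension `n + 1`, once the Cauchy formula is known for
all slices by the last `n` coordinates. -/
theorem torusIntegral_kernel_succ {n : ℕ} {E : Type*} [NormedAddCommGroup E]
    [NormedSpace ℂ E] {c z : Fin (n + 1) → ℂ} {R : ℝ} {f : (Fin (n + 1) → ℂ) → E} {a : ℂ}
    (hz : z ∈ Metric.ball c R) (hf : Continuous fun θ => f (torusMap c (fun _ => R) θ))
    (ih : ∀ x ∈ Metric.sphere (c 0) R,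
      torusIntegral (fun y => (∏ i, (y i - z i.succ)⁻¹) • f (Fin.cons x y)) (c ∘ Fin.succ)
        (fun _ => R) = a • f (Fin.cons x (z ∘ Fin.succ))) :
    torusIntegral (fun x => (∏ i, (x i - z i)⁻¹) • f x) c (fun _ => R) =
      a • ∮ x in C(c 0, R), (x - z 0)⁻¹ • f (Fin.cons x (z ∘ Fin.succ)) := by
  have hR : 0 ≤ R := (Metric.pos_of_mem_ball hz).le
  rw [torusIntegral_succ (torusIntegrable_kernel hz hf), ← circleIntegral.integral_smul]
  refine circleIntegral.integral_congr hR fun x hx => ?_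
  have : (fun y : Fin n → ℂ => (∏ i, ((Fin.cons x y : Fin (n + 1) → ℂ) i - z i)⁻¹) •
      f (Fin.cons x y)) =
      fun y => (x - z 0)⁻¹ • ((∏ i, (y i - z i.succ)⁻¹) • f (Fin.cons x y)) := by
    funext y
    rw [Fin.prod_univ_succ, mul_smul]
    simp
  have h2 : ((fun _ => R) ∘ Fin.succ : Fin n → ℝ) = fun _ => R := rfl
  simp only [this, h2]
  rw [torusIntegral_smul, ih x hx, smul_comm]

theorem tail_mem_ball {n : ℕ} {c z : Fin (n + 1) → ℂ} {R : ℝ} (hz : z ∈ Metric.ball c R) :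
    z ∘ Fin.succ ∈ Metric.ball (c ∘ Fin.succ) R := by
  have hR := Metric.pos_of_mem_ball hz
  rw [Metric.mem_ball, dist_pi_lt_iff hR] at *
  exact fun i => hz i.succ

/-- **Cauchy's integral formula on polydiscs** for continuous separately holomorphic functions. -/
theorem torusIntegral_kernel_eq {n : ℕ} {E : Type*} [NormedAddCommGroup E]
    [NormedSpace ℂ E] [CompleteSpace E] {c z : Fin n → ℂ} {R : ℝ} {f : (Fin n → ℂ) → E}
    (hz : z ∈ Metric.ball c R) (hf : ContinuousOn f (Metric.closedBall c R))
    (hd : ∀ w ∈ Metric.closedBall c R, ∀ i,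
      DifferentiableAt ℂ (fun t => f (Function.update w i t)) (w i)) :
    torusIntegral (fun x => (∏ i, (x i - z i)⁻¹) • f x) c (fun _ => R) =
      ((2 * Real.pi * Complex.I : ℂ) ^ n) • f z := by
  have hR : 0 ≤ R := (Metric.pos_of_mem_ball hz).le
  induction n with
  | zero => 
    rw [torusIntegral_dim0]
    simp [Subsingleton.elim c z]
  | succ n ih =>
    have hfc : Continuous fun θ => f (torusMap c (fun _ => R) θ) :=
      hf.comp_continuous (continuous_torusMap c _) (torusMap_mem_closedBall c hR)
    have hz0 : z 0 ∈ Metric.ball (c 0) R := (dist_le_pi_dist z c 0).trans_lt hz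
    -- The induction hypothesis evaluates the integral over the last `n` coordinates; a one-variable
    -- Cauchy formula handles the first.
    rw [torusIntegral_kernel_succ (a := (2 * Real.pi * Complex.I : ℂ) ^ n) hz hfc]
    · rw [DifferentiableOn.circleIntegral_sub_inv_smul _ hz0]
      · rw [smul_smul, ← pow_succ]
        congr 2
        exact Fin.cons_self_tail z
      · intro x hx
        have := hd (Fin.cons x (z ∘ Fin.succ))
          ((cons_mem_closedBall hR).2 ⟨hx, Metric.ball_subset_closedBall (tail_mem_ball hz)⟩) 0
        simp only [Fin.update_cons_zero, Fin.cons_zero] at this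
        exact this.differentiableWithinAt
    · intro x hx
      refine ih (tail_mem_ball hz) ?_ ?_
      · refine hf.comp (Continuous.continuousOn (by fun_prop)) fun y hy => ?_
        exact (cons_mem_closedBall hR).2 ⟨Metric.sphere_subset_closedBall hx, hy⟩
      · intro w hw i
        exact differentiableAt_slice_cons_succ (hd _
          ((cons_mem_closedBall hR).2 ⟨Metric.sphere_subset_closedBall hx, hw⟩) i.succ)

/-- **Osgood's lemma**: continuous separately holomorphic functions are analytic. -/
theorem contDiffOn_of_separately_differentiable {n : ℕ} {E : Type*} [NormedAddCommGroup E]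
    [NormedSpace ℂ E] [CompleteSpace E] {U : Set (Fin n → ℂ)} (hU : IsOpen U)
    {f : (Fin n → ℂ) → E} (hf : ContinuousOn f U)
    (hd : ∀ w ∈ U, ∀ i, DifferentiableAt ℂ (fun t => f (Function.update w i t)) (w i)) :
    ContDiffOn ℂ ω f U := by
  intro c hc
  obtain ⟨R, hR, hRU⟩ := Metric.nhds_basis_closedBall.mem_iff.1 (hU.mem_nhds hc)
  refine ContDiffAt.contDiffWithinAt ?_
  have hfc : Continuous fun θ => f (torusMap c (fun _ => R) θ) :=
    (hf.mono hRU).comp_continuous (continuous_torusMap c _) (torusMap_mem_closedBall c hR.le)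
  have h1 := (contDiffOn_torusIntegral_kernel hfc).const_smul (((2 * Real.pi * Complex.I : ℂ) ^ n)⁻¹)
  have h2 := h1.contDiffAt (Metric.ball_mem_nhds c hR)
  refine h2.congr_of_eventuallyEq ?_
  filter_upwards [Metric.ball_mem_nhds c hR] with z hz
  rw [torusIntegral_kernel_eq hz (hf.mono hRU) fun w hw => hd w (hRU hw),
    smul_smul, inv_mul_cancel₀, one_smul]
  exact pow_ne_zero _ (by simp [Real.pi_ne_zero])

theorem DifferentiableOn.contDiffOn_pi {n : ℕ} {E : Type*} [NormedAddCommGroup E]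
    [NormedSpace ℂ E] [CompleteSpace E] {U : Set (Fin n → ℂ)} (hU : IsOpen U)
    {f : (Fin n → ℂ) → E} (hf : DifferentiableOn ℂ f U) : ContDiffOn ℂ ω f U := by
  refine contDiffOn_of_separately_differentiable hU hf.continuousOn fun w hw i => ?_
  have h1 : DifferentiableAt ℂ f (Function.update w i (w i)) := by
    rw [Function.update_eq_self]; exact hf.differentiableAt (hU.mem_nhds hw)
  exact h1.comp (w i) (hasFDerivAt_update w (w i)).differentiableAt

theorem Differentiable.contDiff_pi {n : ℕ} {E : Type*} [NormedAddCommGroup E]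
    [NormedSpace ℂ E] [CompleteSpace E] {f : (Fin n → ℂ) → E} (hf : Differentiable ℂ f) :
    ContDiff ℂ ω f :=
  contDiffOn_univ.1 (hf.differentiableOn.contDiffOn_pi isOpen_univ)

/-! ### Hartogs extension across the origin -/

/-- **Hartogs' theorem** for a point: in dimension at least two, a holomorphic function on the
complement of the origin extends to an entire function. -/
theorem exists_differentiable_extension_of_differentiableOn_compl_zero {n : ℕ} {E : Type*}
    [NormedAddCommGroup E] [NormedSpace ℂ E] [CompleteSpace E] {f : (Fin (n + 2) → ℂ) → E}
    (hf : DifferentiableOn ℂ f {0}ᶜ) :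
    ∃ g : (Fin (n + 2) → ℂ) → E, Differentiable ℂ g ∧ ∀ z ≠ 0, g z = f z := by
  have hda {z : Fin (n + 2) → ℂ} (hz : z ≠ 0) : DifferentiableAt ℂ f z :=
    hf.differentiableAt (isOpen_compl_singleton.mem_nhds hz)
  set k : ℂ := (2 * Real.pi * Complex.I : ℂ) ^ (n + 1) * (2 * Real.pi * Complex.I) with hk
  have hk0 : k ≠ 0 := mul_ne_zero (pow_ne_zero _ (by simp [Real.pi_ne_zero]))
    (by simp [Real.pi_ne_zero])
  -- The extension near `0` is the Cauchy integral over the distinguished boundary of the unit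
  -- polydisc, which avoids the origin.
  set g₀ : (Fin (n + 2) → ℂ) → E := fun z => k⁻¹ •
    torusIntegral (fun x => (∏ i, (x i - z i)⁻¹) • f x) 0 (fun _ => 1) with hg₀
  have htn (θ : Fin (n + 2) → ℝ) : torusMap (0 : Fin (n + 2) → ℂ) (fun _ => 1) θ ≠ 0 := by
    intro h
    have := congrFun h 0
    simp [torusMap, Complex.exp_ne_zero] at this
  have hfc : Continuous fun θ => f (torusMap (0 : Fin (n + 2) → ℂ) (fun _ => 1) θ) :=
    hf.continuousOn.comp_continuous (continuous_torusMap _ _) htn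
  have hg₀d : DifferentiableOn ℂ g₀ (Metric.ball 0 1) :=
    ((contDiffOn_torusIntegral_kernel hfc).differentiableOn (by simp)).const_smul _
  -- agreement off the line where all coordinates but the first vanish
  have hagree {z : Fin (n + 2) → ℂ} (hz : z ∈ Metric.ball 0 1) (hz' : z ∘ Fin.succ ≠ 0) :
      g₀ z = f z := by
    have hz0 : z 0 ∈ Metric.ball ((0 : Fin (n + 2) → ℂ) 0) 1 := (dist_le_pi_dist z 0 0).trans_lt hz
    rw [hg₀]
    dsimp only
    rw [torusIntegral_kernel_succ (a := (2 * Real.pi * Complex.I : ℂ) ^ (n + 1)) hz hfc]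
    · rw [DifferentiableOn.circleIntegral_sub_inv_smul _ hz0]
      · rw [smul_smul, smul_smul, mul_assoc, ← hk, inv_mul_cancel₀ hk0, one_smul]
        congr 1
        exact Fin.cons_self_tail z
      -- With the tail of `z` fixed and nonzero, the whole disc in the first coordinate misses the
      -- origin.
      · intro x hx
        refine DifferentiableAt.differentiableWithinAt ?_
        have h1 : DifferentiableAt ℂ f (Fin.cons x (z ∘ Fin.succ)) := by
          refine hda fun h => hz' ?_
          funext i
          simpa using congrFun h i.succ
        refine h1.comp x ?_
        rw [differentiableAt_pi]
        intro i
        refine Fin.cases ?_ (fun j => ?_) i <;> simp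
    -- On the circle `|x| = 1` the first coordinate is nonzero, so the entire slice lies in the
    -- domain of `f` and the polydisc formula applies to it.
    · intro x hx
      have hx0 : x ≠ 0 := by
        rintro rfl
        simp at hx
      have hc0 (y : Fin (n + 1) → ℂ) : (Fin.cons x y : Fin (n + 2) → ℂ) ≠ 0 :=
        fun h => hx0 (by simpa using congrFun h 0)
      refine torusIntegral_kernel_eq (tail_mem_ball hz) ?_ ?_
      · refine hf.continuousOn.comp (Continuous.continuousOn (by fun_prop)) fun y _ => hc0 y
      · intro w hw i
        refine differentiableAt_slice_cons_succ ?_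
        set v : Fin (n + 2) → ℂ := Fin.cons x w
        have h1 : DifferentiableAt ℂ f (Function.update v i.succ (v i.succ)) := by
          rw [Function.update_eq_self]; exact hda (hc0 w)
        exact h1.comp _ (hasFDerivAt_update v _).differentiableAt
  have hagree' {z : Fin (n + 2) → ℂ} (hz : z ∈ Metric.ball 0 1) (hz0 : z ≠ 0) : g₀ z = f z := by
    by_cases hz' : z ∘ Fin.succ = 0
    swap
    · exact hagree hz hz'
    -- A point of the exceptional line is approached by perturbing coordinate `1`, which exists
    -- because the dimension is at least two; both functions are continuous there.
    set p : ℂ → (Fin (n + 2) → ℂ) := fun t => Function.update z 1 t with hp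
    have hpc : Continuous p := continuous_const.update 1 continuous_id
    have hz1 : z 1 = 0 := congrFun hz' 0
    have hp0 : p 0 = z := by rw [hp]; dsimp only; rw [← hz1, Function.update_eq_self]
    have h1 : Filter.Tendsto (g₀ ∘ p) (𝓝[≠] 0) (𝓝 (g₀ z)) := by
      have : ContinuousAt g₀ (p 0) := hp0 ▸
        (hg₀d.differentiableAt (Metric.isOpen_ball.mem_nhds hz)).continuousAt
      simpa [hp0] using (this.comp hpc.continuousAt).tendsto.mono_left nhdsWithin_le_nhds
    have h2 : Filter.Tendsto (f ∘ p) (𝓝[≠] 0) (𝓝 (f z)) := by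
      have : ContinuousAt f (p 0) := hp0 ▸ (hda hz0).continuousAt
      simpa [hp0] using (this.comp hpc.continuousAt).tendsto.mono_left nhdsWithin_le_nhds
    refine tendsto_nhds_unique (h1.congr' ?_) h2
    have h3 : ∀ᶠ t in 𝓝 (0 : ℂ), p t ∈ Metric.ball 0 1 :=
      hpc.continuousAt.preimage_mem_nhds (hp0.symm ▸ Metric.isOpen_ball.mem_nhds hz)
    filter_upwards [h3.filter_mono nhdsWithin_le_nhds, self_mem_nhdsWithin] with t ht ht0
    refine hagree ht fun h => ht0 ?_
    simpa [hp] using congrFun h 0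
  classical
  refine ⟨fun z => if z = 0 then g₀ 0 else f z, fun z => ?_, fun z hz => by simp [hz]⟩
  by_cases hz : z = 0
  · subst hz
    refine ((hg₀d.differentiableAt (Metric.ball_mem_nhds 0 one_pos)).congr_of_eventuallyEq ?_)
    filter_upwards [Metric.ball_mem_nhds (0 : Fin (n + 2) → ℂ) one_pos] with w hw
    split_ifs with h
    · rw [h]
    · exact (hagree' hw h).symm
  · refine (hda hz).congr_of_eventuallyEq ?_
    filter_upwards [isOpen_compl_singleton.mem_nhds hz] with w hw
    exact if_neg hw

/-! ### Integration along rays -/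

section RadialPrimitive

variable {n : ℕ} {E : Type*} [NormedAddCommGroup E] [NormedSpace ℂ E]

/-- The primitive of a one-form along the rays starting at the origin. -/
noncomputable def radialPrimitive (h : (Fin n → ℂ) → (Fin n → ℂ) →L[ℂ] E) (x : Fin n → ℂ) : E :=
  ∫ t in (0 : ℝ)..1, h ((t : ℂ) • x) x

theorem differentiable_intervalIntegral_of_contDiff {Φ : ℂ × (Fin n → ℂ) → E}
    (hΦ : ContDiff ℂ 1 Φ) : Differentiable ℂ fun x => ∫ t in (0 : ℝ)..1, Φ ((t : ℂ), x) := by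
  intro x₀
  have hc : Continuous fun p : ℂ × (Fin n → ℂ) =>
      (fderiv ℂ Φ p).comp (ContinuousLinearMap.inr ℂ ℂ (Fin n → ℂ)) :=
    (hΦ.continuous_fderiv (by simp)).clm_comp continuous_const
  have hK : IsCompact (((fun t : ℝ => (t : ℂ)) '' Icc 0 1) ×ˢ Metric.closedBall x₀ 1) :=
    (isCompact_Icc.image Complex.continuous_ofReal).prod (isCompact_closedBall x₀ 1)
  obtain ⟨C, hC⟩ := hK.exists_bound_of_continuousOn hc.continuousOn
  have hline (x : Fin n → ℂ) : Continuous fun t : ℝ => ((t : ℂ), x) := by fun_prop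
  refine (intervalIntegral.hasFDerivAt_integral_of_dominated_of_fderiv_le (μ := MeasureTheory.volume)
    (s := Metric.closedBall x₀ 1) (bound := fun _ => C)
    (F' := fun x t => (fderiv ℂ Φ ((t : ℂ), x)).comp (ContinuousLinearMap.inr ℂ ℂ (Fin n → ℂ)))
    (Metric.closedBall_mem_nhds x₀ one_pos) ?_ ?_ ?_ ?_ ?_ ?_).differentiableAt
  · exact Filter.Eventually.of_forall fun x =>
      (hΦ.continuous.comp (hline x)).aestronglyMeasurable
  · exact (hΦ.continuous.comp (hline x₀)).intervalIntegrable _ _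
  · exact (hc.comp (hline x₀)).aestronglyMeasurable
  · refine Filter.Eventually.of_forall fun t ht x hx => hC _ ⟨⟨t, ?_, rfl⟩, hx⟩
    rw [uIoc_of_le zero_le_one] at ht
    exact ⟨ht.1.le, ht.2⟩
  · exact intervalIntegrable_const
  · refine Filter.Eventually.of_forall fun t _ x _ => ?_
    have h1 := (hΦ.differentiable (by simp) ((t : ℂ), x)).hasFDerivAt
    exact h1.comp x (hasFDerivAt_prodMk_right (t : ℂ) x)

theorem radialPrimitive_zero (h : (Fin n → ℂ) → (Fin n → ℂ) →L[ℂ] E) :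
    radialPrimitive h 0 = 0 := by
  simp [radialPrimitive]

theorem radialPrimitive_smul (h : (Fin n → ℂ) → (Fin n → ℂ) →L[ℂ] E) (x : Fin n → ℂ) (s : ℝ) :
    radialPrimitive h ((s : ℂ) • x) = ∫ u in (0 : ℝ)..s, h ((u : ℂ) • x) x := by
  have h1 := intervalIntegral.smul_integral_comp_mul_right (a := 0) (b := 1)
    (fun u : ℝ => h ((u : ℂ) • x) x) s
  rw [zero_mul, one_mul] at h1
  rw [← h1, radialPrimitive, ← intervalIntegral.integral_smul]
  refine intervalIntegral.integral_congr fun t _ => ?_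
  simp only [smul_smul, map_smul, Complex.ofReal_mul]
  exact Complex.coe_smul s _

theorem norm_radialPrimitive_le {h : (Fin n → ℂ) → (Fin n → ℂ) →L[ℂ] E} {C r : ℝ}
    (hC : ∀ y ∈ Metric.closedBall 0 r, ‖h y‖ ≤ C) {x : Fin n → ℂ}
    (hx : x ∈ Metric.closedBall 0 r) : ‖radialPrimitive h x‖ ≤ C * r := by
  have hxr : ‖x‖ ≤ r := by simpa using hx
  have hr : 0 ≤ r := (norm_nonneg x).trans hxr
  have hC0 : 0 ≤ C := (norm_nonneg _).trans (hC x hx)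
  have := intervalIntegral.norm_integral_le_of_norm_le_const (a := 0) (b := 1) (C := C * r)
    (f := fun t : ℝ => h ((t : ℂ) • x) x) (fun t ht => by
      rw [uIoc_of_le zero_le_one] at ht
      refine (ContinuousLinearMap.le_opNorm _ _).trans ?_
      refine mul_le_mul (hC _ ?_) hxr (norm_nonneg _) hC0
      rw [mem_closedBall_zero_iff, norm_smul, Complex.norm_real, Real.norm_of_nonneg ht.1.le]
      nlinarith [norm_nonneg x, ht.2])
  simpa [radialPrimitive] using this

theorem HasDerivAt.comp_ofReal_vector {e : ℂ → E} {e' : E} {t : ℝ} (h : HasDerivAt e e' (t : ℂ)) :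
    HasDerivAt (fun t : ℝ => e t) e' t := by
  have h1 := h.scomp t (Complex.ofRealCLM.hasDerivAt (x := t))
  simp only [Complex.ofRealCLM_apply, Complex.ofReal_one, one_smul] at h1
  exact h1

variable [CompleteSpace E]

theorem differentiable_radialPrimitive {h : (Fin n → ℂ) → (Fin n → ℂ) →L[ℂ] E}
    (hh : Differentiable ℂ h) : Differentiable ℂ (radialPrimitive h) := by
  have h1 : ContDiff ℂ 1 h := hh.contDiff_pi.of_le (by simp)
  refine differentiable_intervalIntegral_of_contDiff (Φ := fun p => h (p.1 • p.2) p.2) ?_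
  exact (h1.comp (contDiff_fst.smul contDiff_snd)).clm_apply contDiff_snd

/-- Along the ray through `x` the primitive is `∫₀ˢ h(ux)x du`, and the fundamental theorem of
calculus applies at `s = 1`. Only the radial derivative is computed, so `h` need not be closed. -/
theorem fderiv_radialPrimitive_self {h : (Fin n → ℂ) → (Fin n → ℂ) →L[ℂ] E}
    (hh : Differentiable ℂ h) (x : Fin n → ℂ) : fderiv ℂ (radialPrimitive h) x x = h x x := by
  have hc : Continuous fun u : ℝ => h ((u : ℂ) • x) x :=
    (hh.continuous.comp (by fun_prop : Continuous fun u : ℝ => (u : ℂ) • x)).clm_apply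
      continuous_const
  have h1 : HasDerivAt (fun s : ℝ => radialPrimitive h ((s : ℂ) • x)) (h x x) 1 := by
    simp only [radialPrimitive_smul]
    simpa using intervalIntegral.integral_hasDerivAt_right (hc.intervalIntegrable 0 1)
      (hc.stronglyMeasurableAtFilter _ _) hc.continuousAt
  have h2 : HasDerivAt (fun s : ℂ => radialPrimitive h (s • x))
      (fderiv ℂ (radialPrimitive h) x x) ((1 : ℝ) : ℂ) := by
    have h3 : HasFDerivAt (radialPrimitive h) (fderiv ℂ (radialPrimitive h) x)
        (((1 : ℝ) : ℂ) • x) := by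
      simpa using (differentiable_radialPrimitive hh x).hasFDerivAt
    have h4 : HasDerivAt (fun s : ℂ => s • x) x ((1 : ℝ) : ℂ) := by
      simpa using (hasDerivAt_id ((1 : ℝ) : ℂ)).smul_const x
    exact h3.comp_hasDerivAt _ h4
  exact h2.comp_ofReal_vector.unique h1

end RadialPrimitive

/-! ### Parallel frames of a flat connection form -/

section ParallelFrame

variable {n : ℕ} {𝔸 : Type*} [NormedRing 𝔸] [NormedAlgebra ℂ 𝔸]

/-- The one-form `g Ω` with values in an algebra. -/
noncomputable def mulForm (g : (Fin n → ℂ) → 𝔸) (Ω : (Fin n → ℂ) → (Fin n → ℂ) →L[ℂ] 𝔸)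
    (x : Fin n → ℂ) : (Fin n → ℂ) →L[ℂ] 𝔸 :=
  (ContinuousLinearMap.mul ℂ 𝔸 (g x)).comp (Ω x)

@[simp]
theorem mulForm_apply (g : (Fin n → ℂ) → 𝔸) (Ω : (Fin n → ℂ) → (Fin n → ℂ) →L[ℂ] 𝔸)
    (x v : Fin n → ℂ) : mulForm g Ω x v = g x * Ω x v := rfl

theorem differentiable_mulForm {g : (Fin n → ℂ) → 𝔸} {Ω : (Fin n → ℂ) → (Fin n → ℂ) →L[ℂ] 𝔸}
    (hg : Differentiable ℂ g) (hΩ : Differentiable ℂ Ω) : Differentiable ℂ (mulForm g Ω) :=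
  ((ContinuousLinearMap.mul ℂ 𝔸).differentiable.comp hg).clm_comp hΩ

/-- The terms of the Picard series solving `∂_x G (x) = G (x) Ω_x (x)`, `G (0) = 1`. -/
noncomputable def picardTerm (Ω : (Fin n → ℂ) → (Fin n → ℂ) →L[ℂ] 𝔸) : ℕ → (Fin n → ℂ) → 𝔸
  | 0 => fun _ => 1
  | j + 1 => radialPrimitive (mulForm (picardTerm Ω j) Ω)

/-- A function of a real variable solving `e' = e a`, `e (0) = 0` vanishes. -/
theorem eq_zero_of_hasDerivAt_mul {e a : ℝ → 𝔸} (ha : ContinuousOn a (Icc 0 1))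
    (he : ∀ t ∈ Icc (0 : ℝ) 1, HasDerivAt e (e t * a t) t) (h0 : e 0 = 0) : e 1 = 0 := by
  obtain ⟨K, hK⟩ := isCompact_Icc.exists_bound_of_continuousOn ha
  refine eq_zero_of_abs_deriv_le_mul_abs_self_of_eq_zero_right (K := K) (a := 0) (b := 1)
    (f' := fun t => e t * a t)
    (fun t ht => (he t ht).continuousAt.continuousWithinAt)
    (fun t ht => (he t (Ico_subset_Icc_self ht)).hasDerivWithinAt) h0 (fun t ht => ?_) 1
    (right_mem_Icc.2 zero_le_one)
  rw [mul_comm]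
  exact (norm_mul_le _ _).trans (mul_le_mul_of_nonneg_left (hK t (Ico_subset_Icc_self ht))
    (norm_nonneg _))

/-- Each multiplication by `Ω` followed by radial integration costs a factor `M * r ≤ 1 / 2`, which
gives a geometric majorant for the Picard series. -/
theorem norm_picardTerm_le {Ω : (Fin n → ℂ) → (Fin n → ℂ) →L[ℂ] 𝔸} {M r : ℝ}
    (hM : ∀ y ∈ Metric.closedBall 0 r, ‖Ω y‖ ≤ M) (hr : M * r ≤ 1 / 2) (j : ℕ)
    {x : Fin n → ℂ} (hx : x ∈ Metric.closedBall 0 r) :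
    ‖picardTerm Ω j x‖ ≤ ‖(1 : 𝔸)‖ * (1 / 2) ^ j := by
  induction j generalizing x with
  | zero => simp [picardTerm]
  | succ j ih =>
    refine (norm_radialPrimitive_le (C := ‖(1 : 𝔸)‖ * (1 / 2) ^ j * M) (fun y hy => ?_) hx).trans ?_
    · refine (ContinuousLinearMap.opNorm_comp_le _ _).trans ?_
      refine mul_le_mul ((ContinuousLinearMap.opNorm_mul_apply_le ℂ 𝔸 _).trans (ih hy)) (hM y hy)
        (norm_nonneg _) (by positivity)
    · rw [pow_succ, mul_assoc, ← mul_assoc ‖(1 : 𝔸)‖]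
      gcongr

theorem smul_mem_ball_zero {r : ℝ} {x : Fin n → ℂ} (hx : x ∈ Metric.ball 0 r) {t : ℝ}
    (ht : t ∈ Icc (0 : ℝ) 1) : (t : ℂ) • x ∈ Metric.ball 0 r := by
  rw [mem_ball_zero_iff] at *
  rw [norm_smul, Complex.norm_real, Real.norm_of_nonneg ht.1]
  nlinarith [norm_nonneg x, ht.2]

/-- Parallel frames are determined by their value at the origin. -/
theorem parallel_unique {Ω : (Fin n → ℂ) → (Fin n → ℂ) →L[ℂ] 𝔸} (hΩ : Differentiable ℂ Ω)
    {r : ℝ} {G₁ G₂ : (Fin n → ℂ) → 𝔸} (h0 : G₁ 0 = G₂ 0)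
    (h₁ : ∀ x ∈ Metric.ball 0 r, HasFDerivAt G₁ (mulForm G₁ Ω x) x)
    (h₂ : ∀ x ∈ Metric.ball 0 r, HasFDerivAt G₂ (mulForm G₂ Ω x) x) :
    EqOn G₁ G₂ (Metric.ball 0 r) := by
  intro x hx
  have hlin (s : ℂ) : HasDerivAt (fun s : ℂ => s • x) x s := by
    simpa using (hasDerivAt_id s).smul_const x
  have hac : ContinuousOn (fun t : ℝ => Ω ((t : ℂ) • x) x) (Icc 0 1) :=
    ((hΩ.continuous.comp (by fun_prop : Continuous fun t : ℝ => (t : ℂ) • x)).clm_apply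
      continuous_const).continuousOn
  -- On the ray through `x` both frames solve the same linear equation `y' = y Ω(tx)x`, and their
  -- difference starts at `0`.
  have := eq_zero_of_hasDerivAt_mul (e := fun t : ℝ => G₁ ((t : ℂ) • x) - G₂ ((t : ℂ) • x)) hac
    (fun t ht => ?_) (by simp [h0])
  · simpa [sub_eq_zero] using this
  · have hy := smul_mem_ball_zero hx ht
    have h3 := ((h₁ _ hy).comp_hasDerivAt (t : ℂ) (hlin t)).sub
      ((h₂ _ hy).comp_hasDerivAt (t : ℂ) (hlin t))
    refine h3.comp_ofReal_vector.congr_deriv ?_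
    simp [sub_mul]

variable [CompleteSpace 𝔸]

theorem differentiable_picardTerm {Ω : (Fin n → ℂ) → (Fin n → ℂ) →L[ℂ] 𝔸}
    (hΩ : Differentiable ℂ Ω) (j : ℕ) : Differentiable ℂ (picardTerm Ω j) := by
  induction j with
  | zero => exact differentiable_const _
  | succ j ih => exact differentiable_radialPrimitive (differentiable_mulForm ih hΩ)

/-- The sum of the Picard series is the frame. Uniform convergence makes it continuous and
holomorphic in each variable, hence holomorphic by Osgood's lemma; its radial equation comes from
termwise differentiation along rays. Flatness plays no role for the radial direction alone. -/
theorem exists_radially_parallel {Ω : (Fin n → ℂ) → (Fin n → ℂ) →L[ℂ] 𝔸}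
    (hΩ : Differentiable ℂ Ω) :
    ∃ r > 0, ∃ G : (Fin n → ℂ) → 𝔸, DifferentiableOn ℂ G (Metric.ball 0 r) ∧ G 0 = 1 ∧
      ∀ x ∈ Metric.ball 0 r, fderiv ℂ G x x = G x * Ω x x := by
  obtain ⟨M₀, hM₀⟩ := (isCompact_closedBall (0 : Fin n → ℂ) 1).exists_bound_of_continuousOn
    hΩ.continuous.continuousOn
  set M := max M₀ 0 + 1 with hMdef
  have hM1 : 1 ≤ M := by simp [hMdef]
  -- This gives `M * r = 1 / 2`, and `M ≥ 1` forces `r ≤ 1`, so the bound found on the unit ball is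
  -- available.
  set r : ℝ := 1 / (2 * M) with hrdef
  have hr0 : 0 < r := by positivity
  have hr1 : r ≤ 1 := by
    rw [hrdef, div_le_one (by positivity)]; linarith
  have hMr : M * r ≤ 1 / 2 := by
    rw [hrdef]; field_simp; norm_num
  have hM : ∀ y ∈ Metric.closedBall (0 : Fin n → ℂ) r, ‖Ω y‖ ≤ M := fun y hy =>
    (hM₀ y (Metric.closedBall_subset_closedBall hr1 hy)).trans
      ((le_max_left M₀ 0).trans (by rw [hMdef]; linarith))
  set B := Metric.ball (0 : Fin n → ℂ) r with hB
  have hbd (j : ℕ) (x : Fin n → ℂ) (hx : x ∈ B) :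
      ‖picardTerm Ω j x‖ ≤ ‖(1 : 𝔸)‖ * (1 / 2) ^ j :=
    norm_picardTerm_le hM hMr j (Metric.ball_subset_closedBall hx)
  have hsum : Summable fun j : ℕ => ‖(1 : 𝔸)‖ * (1 / 2 : ℝ) ^ j := summable_geometric_two.mul_left _
  have hpt (x : Fin n → ℂ) (hx : x ∈ B) : Summable fun j => picardTerm Ω j x :=
    hsum.of_norm_bounded fun j => hbd j x hx
  set G : (Fin n → ℂ) → 𝔸 := fun x => ∑' j, picardTerm Ω j x with hG
  have hGd : DifferentiableOn ℂ G B := by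
    refine ContDiffOn.differentiableOn (n := ω) ?_ (by simp)
    refine contDiffOn_of_separately_differentiable Metric.isOpen_ball ?_ fun w hw i => ?_
    · exact continuousOn_tsum (fun j => (differentiable_picardTerm hΩ j).continuous.continuousOn)
        hsum hbd
    · have ho : IsOpen {t : ℂ | Function.update w i t ∈ B} :=
        Metric.isOpen_ball.preimage
          (continuous_const.update i continuous_id : Continuous fun t : ℂ => Function.update w i t)
      refine (Complex.differentiableOn_tsum_of_summable_norm hsum (fun j t _ => ?_) ho
        (fun j t ht => hbd j _ ht)).differentiableAt (ho.mem_nhds ?_)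
      · exact ((differentiable_picardTerm hΩ j _).comp t
          (hasFDerivAt_update w t).differentiableAt).differentiableWithinAt
      · change Function.update w i (w i) ∈ B
        rwa [Function.update_eq_self]
  refine ⟨r, hr0, G, hGd, ?_, fun x hx => ?_⟩
  · rw [hG]
    dsimp only
    rw [tsum_eq_single 0]
    · rfl
    · rintro (_ | j) hj
      · exact absurd rfl hj
      · exact radialPrimitive_zero _
  · have ho : IsOpen {s : ℂ | s • x ∈ B} :=
      Metric.isOpen_ball.preimage (by fun_prop : Continuous fun s : ℂ => s • x)
    have hline {f : (Fin n → ℂ) → 𝔸} {s : ℂ} (hf : DifferentiableAt ℂ f (s • x)) :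
        HasDerivAt (fun s : ℂ => f (s • x)) (fderiv ℂ f (s • x) x) s := by
      have h4 : HasDerivAt (fun s : ℂ => s • x) x s := by
        simpa using (hasDerivAt_id s).smul_const x
      exact hf.hasFDerivAt.comp_hasDerivAt s h4
    have h1 := Complex.hasSum_deriv_of_summable_norm (z := 1)
      (F := fun j s => picardTerm Ω j (s • x)) hsum
      (fun j s _ => (hline (differentiable_picardTerm hΩ j _)).differentiableAt.differentiableWithinAt)
      ho (fun j s hs => hbd j _ hs) (by rwa [mem_ofPred_eq, one_smul])
    have h2 : deriv (fun s : ℂ => G (s • x)) 1 = fderiv ℂ G x x := by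
      have := (hline (f := G) (s := 1)
        (hGd.differentiableAt (Metric.isOpen_ball.mem_nhds (by rwa [one_smul])))).deriv
      simpa using this
    have h3 (j : ℕ) : deriv (fun s : ℂ => picardTerm Ω (j + 1) (s • x)) 1
        = picardTerm Ω j x * Ω x x := by
      rw [(hline (differentiable_picardTerm hΩ (j + 1) _)).deriv, one_smul]
      exact fderiv_radialPrimitive_self
        (differentiable_mulForm (differentiable_picardTerm hΩ j) hΩ) x
    -- The zeroth term is constant; dropping it and shifting the index turns the derivative series
    -- into the series of `G` times `Ω x x`.
    have h4 := (hasSum_nat_add_iff' (G := 𝔸) 1).2 h1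
    simp only [h3, Finset.range_one, Finset.sum_singleton] at h4
    have h5 : deriv (fun s : ℂ => picardTerm Ω 0 (s • x)) 1 = 0 := by
      simp [picardTerm]
    rw [h5, sub_zero] at h4
    rw [← h2]
    exact h4.unique ((hpt x hx).hasSum.mul_right _)

/-- The noncommutative algebra behind flatness. Here `g` is the frame at `y`, `a` its derivative
along `v`, `o = Ω(y)`, `w = Ω(v)`, and `p`, `q`, `s` are second-order terms. Flatness turns the
differentiated radial equation into a homogeneous equation for the defect `a - g * w`. -/
theorem radial_defect_identity {R : Type*} [Ring R] {a g w o p q s : R}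
    (h : p + a = a * o + g * (q + w)) (hflat : s - q + o * w - w * o = 0) :
    p - (g * o * w + g * s) + (a - g * w) = (a - g * w) * o := by
  have hp : p = a * o + g * (q + w) - a := eq_sub_of_add_eq h
  have hs : s = q - o * w + w * o := by
    rw [← sub_eq_zero, ← hflat]; abel
  rw [hp, hs]
  noncomm_ring

/-- A flat connection form admits a parallel frame near the origin. -/
theorem exists_parallel_of_flat {Ω : (Fin n → ℂ) → (Fin n → ℂ) →L[ℂ] 𝔸}
    (hΩ : Differentiable ℂ Ω)
    (hflat : ∀ x u v, fderiv ℂ Ω x u v - fderiv ℂ Ω x v u + Ω x u * Ω x v - Ω x v * Ω x u = 0) :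
    ∃ r > 0, ∃ G : (Fin n → ℂ) → 𝔸, G 0 = 1 ∧
      ∀ x ∈ Metric.ball 0 r, HasFDerivAt G (mulForm G Ω x) x := by
  obtain ⟨r, hr, G, hGd, hG0, hGr⟩ := exists_radially_parallel hΩ
  refine ⟨r, hr, G, hG0, fun x hx => ?_⟩
  have hGc : ContDiffOn ℂ ω G (Metric.ball 0 r) := hGd.contDiffOn_pi Metric.isOpen_ball
  have hca {y : Fin n → ℂ} (hy : y ∈ Metric.ball 0 r) : ContDiffAt ℂ ω G y :=
    hGc.contDiffAt (Metric.isOpen_ball.mem_nhds hy)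
  have hda {y : Fin n → ℂ} (hy : y ∈ Metric.ball 0 r) : HasFDerivAt G (fderiv ℂ G y) y :=
    ((hca hy).differentiableAt (by simp)).hasFDerivAt
  have hda2 {y : Fin n → ℂ} (hy : y ∈ Metric.ball 0 r) :
      HasFDerivAt (fderiv ℂ G) (fderiv ℂ (fderiv ℂ G) y) y :=
    (((hca hy).fderiv_right (m := 1) (by simp)).differentiableAt (by simp)).hasFDerivAt
  have hΩd (y : Fin n → ℂ) : HasFDerivAt Ω (fderiv ℂ Ω y) y := (hΩ y).hasFDerivAt
  -- the radial equation, differentiated in an arbitrary direction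
  have hrad {y : Fin n → ℂ} (hy : y ∈ Metric.ball 0 r) (v : Fin n → ℂ) :
      fderiv ℂ (fderiv ℂ G) y v y + fderiv ℂ G y v =
        fderiv ℂ G y v * Ω y y + G y * (fderiv ℂ Ω y v y + Ω y v) := by
    have h1 := (hda2 hy).clm_apply (hasFDerivAt_id y)
    have h2 := (hda hy).mul' ((hΩd y).clm_apply (hasFDerivAt_id y))
    have h3 := h1.unique (h2.congr_of_eventuallyEq (by
      filter_upwards [Metric.isOpen_ball.mem_nhds hy] with w hw
      exact hGr w hw))
    have h4 := congrArg (fun T : (Fin n → ℂ) →L[ℂ] 𝔸 => T v) h3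
    simp at h4
    rw [add_comm, h4, mul_add]
    abel
  suffices fderiv ℂ G x = mulForm G Ω x from this ▸ hda hx
  ext v
  rw [mulForm_apply, ← sub_eq_zero]
  -- This is `s` times the failure of the parallel equation in direction `v` at `s • x`. It vanishes
  -- at `s = 0` and solves `e' = e Ω(sx)x`, so it vanishes at `s = 1`.
  set e : ℂ → 𝔸 := fun s => s • (fderiv ℂ G (s • x) v - G (s • x) * Ω (s • x) v) with he
  have hlin (s : ℂ) : HasDerivAt (fun s : ℂ => s • x) x s := by
    simpa using (hasDerivAt_id s).smul_const x
  have hed (t : ℝ) (ht : t ∈ Icc (0 : ℝ) 1) :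
      HasDerivAt (fun t : ℝ => e t) (e t * Ω ((t : ℂ) • x) x) t := by
    refine HasDerivAt.comp_ofReal_vector (e := e) ?_
    have hy := smul_mem_ball_zero hx ht
    -- The factor `t` in `e` absorbs the argument `x` into `y = t • x`. The radial equation at `y`
    -- can then be used without dividing by `t`, including at `t = 0`.
    obtain ⟨y, hydef⟩ : ∃ y, y = (t : ℂ) • x := ⟨_, rfl⟩
    have hmap {W : Type _} [NormedAddCommGroup W] [NormedSpace ℂ W] (T : (Fin n → ℂ) →L[ℂ] W) :
        (t : ℂ) • T x = T y := by rw [hydef, map_smul]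
    rw [← hydef] at hy ⊢
    have h1 : HasDerivAt (fun s : ℂ => fderiv ℂ G (s • x) v) (fderiv ℂ (fderiv ℂ G) y x v) t := by
      simpa using ((hda2 hy).comp_hasDerivAt_of_eq (t : ℂ) (hlin t) hydef).clm_apply
        (hasDerivAt_const (t : ℂ) v)
    have h2 : HasDerivAt (fun s : ℂ => G (s • x)) (fderiv ℂ G y x) t :=
      (hda hy).comp_hasDerivAt_of_eq (t : ℂ) (hlin t) hydef
    have h3 : HasDerivAt (fun s : ℂ => Ω (s • x) v) (fderiv ℂ Ω y x v) t := by
      simpa using ((hΩd y).comp_hasDerivAt_of_eq (t : ℂ) (hlin t) hydef).clm_apply (hasDerivAt_const (t : ℂ) v)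
    have h4 : HasDerivAt e ((t : ℂ) • (fderiv ℂ (fderiv ℂ G) y x v -
        (fderiv ℂ G y x * Ω y v + G y * fderiv ℂ Ω y x v)) +
        (1 : ℂ) • (fderiv ℂ G y v - G y * Ω y v)) (t : ℂ) := by
      simp only [hydef] at h1 h2 h3 ⊢
      exact (hasDerivAt_id (t : ℂ)).smul (h1.sub (h2.mul h3))
    refine h4.congr_deriv ?_
    have hsymm : fderiv ℂ (fderiv ℂ G) y y v = fderiv ℂ (fderiv ℂ G) y v y :=
      (hca hy).isSymmSndFDerivAt_of_omega y v
    have e1 : (t : ℂ) • fderiv ℂ (fderiv ℂ G) y x v = fderiv ℂ (fderiv ℂ G) y v y :=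
      (congrArg (fun T : (Fin n → ℂ) →L[ℂ] 𝔸 => T v) (hmap (fderiv ℂ (fderiv ℂ G) y))).trans hsymm
    have e2 : (t : ℂ) • fderiv ℂ G y x = G y * Ω y y := (hmap _).trans (hGr y hy)
    have e3 : (t : ℂ) • fderiv ℂ Ω y x v = fderiv ℂ Ω y y v :=
      congrArg (fun T : (Fin n → ℂ) →L[ℂ] 𝔸 => T v) (hmap (fderiv ℂ Ω y))
    have e4 : (t : ℂ) • Ω y x = Ω y y := hmap _
    have e5 : e t * Ω y x = (fderiv ℂ G y v - G y * Ω y v) * Ω y y := by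
      rw [← e4, he]
      dsimp only
      rw [smul_mul_assoc, mul_smul_comm, ← hydef]
    rw [e5, one_smul, smul_sub, smul_add, e1, ← smul_mul_assoc, e2, ← mul_smul_comm, e3]
    exact radial_defect_identity (hrad hy v) (hflat y y v)
  have hac : ContinuousOn (fun t : ℝ => Ω ((t : ℂ) • x) x) (Icc 0 1) :=
    ((hΩ.continuous.comp (by fun_prop : Continuous fun t : ℝ => (t : ℂ) • x)).clm_apply
      continuous_const).continuousOn
  have := eq_zero_of_hasDerivAt_mul hac hed (by simp [he])
  simpa [he] using this

end ParallelFrame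

/-! ### Dynamics of contractions: extending equivariant germs -/

namespace HolomorphicContraction

variable {n : ℕ} (γ : HolomorphicContraction n)

theorem contDiff_iterate (k : ℕ) : ContDiff ℂ ω γ.toFun^[k] := by
  induction k with
  | zero => exact contDiff_id
  | succ k ih => exact ih.comp γ.contDiff_toFun

theorem iterate_zero_apply (k : ℕ) : γ.toFun^[k] 0 = 0 :=
  Function.iterate_fixed γ.isContraction.apply_eq k

theorem exists_forall_iterate_mem {U K : Set (Fin n → ℂ)} (hU : U ∈ 𝓝 0) (hK : IsCompact K) :
    ∃ N, ∀ k ≥ N, ∀ x ∈ K, γ.toFun^[k] x ∈ U := by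
  obtain ⟨N, hN⟩ := γ.isContraction.eventually_image_subset K hK _ isOpen_interior
    (mem_interior_iff_mem_nhds.2 hU)
  exact ⟨N, fun k hk x hx => interior_subset (hN k hk ⟨x, hx, rfl⟩)⟩

/-- Points close to the origin never leave a given neighborhood of the origin. -/
theorem eventually_forall_iterate_mem {U : Set (Fin n → ℂ)} (hU : U ∈ 𝓝 0) :
    ∀ᶠ x in 𝓝 (0 : Fin n → ℂ), ∀ k, γ.toFun^[k] x ∈ U := by
  obtain ⟨N, hN⟩ := γ.exists_forall_iterate_mem hU (isCompact_closedBall (0 : Fin n → ℂ) 1)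
  have h1 : ∀ᶠ x in 𝓝 (0 : Fin n → ℂ), ∀ k ∈ Finset.range N, γ.toFun^[k] x ∈ U := by
    rw [Filter.eventually_all_finset]
    intro k _
    refine (γ.contDiff_iterate k).continuous.continuousAt.preimage_mem_nhds ?_
    rwa [γ.iterate_zero_apply]
  filter_upwards [h1, Metric.closedBall_mem_nhds (0 : Fin n → ℂ) one_pos] with x hx hx1 k
  rcases lt_or_ge k N with hk | hk
  · exact hx k (Finset.mem_range.2 hk)
  · exact hN k hk x hx1

/-- A germ at the origin of an equivariant holomorphic map extends to an equivariant entire map. -/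
theorem exists_equivariant_extension (δ : (Fin n → ℂ) ≃ (Fin n → ℂ)) (hδ : ContDiff ℂ ω δ.symm)
    {F : (Fin n → ℂ) → (Fin n → ℂ)} (hF : ∀ᶠ x in 𝓝 0, ContDiffAt ℂ ω F x)
    (hFγ : ∀ᶠ x in 𝓝 0, F (γ.toFun x) = δ (F x)) :
    ∃ Φ : (Fin n → ℂ) → (Fin n → ℂ), ContDiff ℂ ω Φ ∧ (∀ x, Φ (γ.toFun x) = δ (Φ x)) ∧
      Φ =ᶠ[𝓝 0] F := by
  set U : Set (Fin n → ℂ) := {x | ContDiffAt ℂ ω F x ∧ F (γ.toFun x) = δ (F x)} with hU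
  have hU0 : U ∈ 𝓝 0 := hF.and hFγ
  have hex (x : Fin n → ℂ) : ∃ k, ∀ j ≥ k, γ.toFun^[j] x ∈ U := by
    obtain ⟨N, hN⟩ := γ.exists_forall_iterate_mem hU0 (isCompact_singleton (x := x))
    exact ⟨N, fun j hj => hN j hj x rfl⟩
  choose k hk using hex
  -- Push `x` towards the origin with `γ`, apply the germ, and pull back with `δ`. Equivariance of
  -- the germ makes `P m x` independent of `m` once the orbit remains in `U`.
  set P : ℕ → (Fin n → ℂ) → (Fin n → ℂ) := fun m x => δ.symm^[m] (F (γ.toFun^[m] x)) with hP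
  have hstep {x : Fin n → ℂ} {m : ℕ} (hm : γ.toFun^[m] x ∈ U) : P (m + 1) x = P m x := by
    simp only [hP]
    rw [Function.iterate_succ_apply, Function.iterate_succ_apply', hm.2, δ.symm_apply_apply]
  have hmono {x : Fin n → ℂ} {a b : ℕ} (ha : ∀ j ≥ a, γ.toFun^[j] x ∈ U) (hab : a ≤ b) :
      P b x = P a x := by
    induction b, hab using Nat.le_induction with
    | base => rfl
    | succ b hb ih => rw [hstep (ha b hb), ih]
  have hind {x : Fin n → ℂ} {a : ℕ} (ha : ∀ j ≥ a, γ.toFun^[j] x ∈ U) : P (k x) x = P a x := by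
    rw [← hmono ha (le_max_right (k x) a), ← hmono (hk x) (le_max_left (k x) a)]
  have hδk (m : ℕ) : ContDiff ℂ ω δ.symm^[m] := by
    induction m with
    | zero => exact contDiff_id
    | succ m ih => exact ih.comp hδ
  refine ⟨fun x => P (k x) x, ?_, fun x => ?_, ?_⟩
  · rw [contDiff_iff_contDiffAt]
    intro x
    -- One exponent serves a whole neighborhood of `x` by compactness, so the extension coincides
    -- there with the analytic map `P N`.
    obtain ⟨N, hN⟩ := γ.exists_forall_iterate_mem hU0 (isCompact_closedBall x 1)
    have h1 : ContDiffAt ℂ ω (P N) x := by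
      refine (hδk N).contDiffAt.comp x (ContDiffAt.comp x ?_ (γ.contDiff_iterate N).contDiffAt)
      exact (hN N le_rfl x (Metric.mem_closedBall_self zero_le_one)).1
    refine h1.congr_of_eventuallyEq ?_
    filter_upwards [Metric.closedBall_mem_nhds x one_pos] with y hy
    exact hind fun j hj => hN j hj y hy
  · have h1 : ∀ j ≥ k x, γ.toFun^[j] (γ.toFun x) ∈ U := fun j hj => by
      rw [← Function.iterate_succ_apply]
      exact hk x _ (by omega)
    have h2 : P (k x) x = P (k x + 1) x := hind fun j hj => hk x j (by omega)
    dsimp only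
    rw [hind h1, h2]
    simp only [hP]
    rw [Function.iterate_succ_apply' δ.symm, δ.apply_symm_apply, Function.iterate_succ_apply]
  · filter_upwards [γ.eventually_forall_iterate_mem hU0] with x hx
    exact hind (a := 0) fun j _ => hx j

/-- An equivariant map which is the identity near the origin is the identity. -/
theorem eq_id_of_equivariant {Φ : (Fin n → ℂ) → (Fin n → ℂ)}
    (h : ∀ x, Φ (γ.toFun x) = γ.toFun (Φ x)) (h0 : ∀ᶠ x in 𝓝 0, Φ x = x) (x : Fin n → ℂ) :
    Φ x = x := by
  obtain ⟨N, hN⟩ := γ.exists_forall_iterate_mem h0 (isCompact_singleton (x := x))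
  have h1 : Φ (γ.toFun^[N] x) = γ.toFun^[N] x := hN N le_rfl x rfl
  have h2 : Function.Semiconj Φ γ.toFun γ.toFun := h
  rw [(h2.iterate_right N).eq] at h1
  exact (γ.toEquiv.injective.iterate N) h1

/-- A linear map which is locally conjugate to a contraction is a contraction. -/
theorem isContractionCenteredAt_of_conj {F : (Fin n → ℂ) → (Fin n → ℂ)}
    {A : (Fin n → ℂ) →L[ℂ] (Fin n → ℂ)} (hF0 : F 0 = 0) (hFc : ContinuousAt F 0)
    (hFo : 𝓝 0 ≤ Filter.map F (𝓝 0)) (hFγ : ∀ᶠ x in 𝓝 0, F (γ.toFun x) = A (F x)) :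
    IsContractionCenteredAt A 0 := by
  refine ⟨A.continuous, map_zero A, fun K hK U hU hU0 => ?_⟩
  have hW := (γ.eventually_forall_iterate_mem hFγ).and
    (Metric.closedBall_mem_nhds (0 : Fin n → ℂ) one_pos)
  -- Every point of this ball is `F x` for some `x` in the unit ball whose whole orbit obeys the
  -- conjugacy, so `A^[k] (F x) = F (γ^[k] x)` for all `k`.
  obtain ⟨ε, hε, hball⟩ := Metric.nhds_basis_closedBall.mem_iff.1 (hFo (Filter.image_mem_map hW))
  have hiter {x : Fin n → ℂ} (hx : ∀ k, γ.toFun^[k] x ∈ {x | F (γ.toFun x) = A (F x)}) (k : ℕ) :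
      A^[k] (F x) = F (γ.toFun^[k] x) := by
    induction k with
    | zero => rfl
    | succ k ih =>
      rw [Function.iterate_succ_apply', Function.iterate_succ_apply', ih]
      exact (hx k).symm
  have hlin (k : ℕ) (a : ℂ) (x : Fin n → ℂ) : A^[k] (a • x) = a • A^[k] x := by
    induction k with
    | zero => rfl
    | succ k ih => rw [Function.iterate_succ_apply', Function.iterate_succ_apply', ih, map_smul]
  obtain ⟨R₀, hR₀⟩ := hK.isBounded.subset_closedBall (0 : Fin n → ℂ)
  set R : ℝ := max R₀ 1 with hRdef
  have hR : 0 < R := lt_of_lt_of_le one_pos (le_max_right _ _)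
  -- Dividing by `a` shrinks `K` into the ball of radius `ε`; linearity of `A` allows scaling back,
  -- at the price of asking `F ∘ γ^[k]` to enter `a⁻¹ U`.
  set a : ℂ := ((R / ε : ℝ) : ℂ) with ha
  have ha0 : a ≠ 0 := by rw [ha]; exact_mod_cast (div_pos hR hε).ne'
  have hU' : {y : Fin n → ℂ | a • y ∈ U} ∈ 𝓝 (F 0) := by
    refine (continuous_const_smul a).continuousAt.preimage_mem_nhds (hU.mem_nhds ?_)
    rwa [hF0, smul_zero]
  obtain ⟨N, hN⟩ := γ.exists_forall_iterate_mem (hFc.preimage_mem_nhds hU')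
    (isCompact_closedBall (0 : Fin n → ℂ) 1)
  refine ⟨N, fun k hk => ?_⟩
  rintro _ ⟨w, hw, rfl⟩
  have hwR : ‖w‖ ≤ R := (mem_closedBall_zero_iff.1 (hR₀ hw)).trans (le_max_left _ _)
  have hw' : a⁻¹ • w ∈ Metric.closedBall (0 : Fin n → ℂ) ε := by
    rw [mem_closedBall_zero_iff, norm_smul, norm_inv, ha, Complex.norm_real,
      Real.norm_of_nonneg (div_pos hR hε).le, inv_div, div_mul_eq_mul_div, div_le_iff₀ hR]
    gcongr
  obtain ⟨x, ⟨hx, hx1⟩, hxw⟩ := hball hw'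
  have h1 : a • F (γ.toFun^[k] x) ∈ U := hN k hk x hx1
  rwa [← hiter hx, hxw, ← hlin, smul_smul, mul_inv_cancel₀ ha0, one_smul] at h1

end HolomorphicContraction

/-! ### Linearizing a contraction, locally and globally -/

theorem ContinuousLinearEquiv.exists_generalLinearGroup {n : ℕ}
    (A : (Fin n → ℂ) ≃L[ℂ] (Fin n → ℂ)) :
    ∃ B : GL (Fin n) ℂ, ∀ z, A z = (B : Matrix (Fin n) (Fin n) ℂ).mulVec z := by
  refine ⟨⟨LinearMap.toMatrix' (A : (Fin n → ℂ) →ₗ[ℂ] (Fin n → ℂ)),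
    LinearMap.toMatrix' (A.symm : (Fin n → ℂ) →ₗ[ℂ] (Fin n → ℂ)), ?_, ?_⟩, fun z => ?_⟩
  · rw [← LinearMap.toMatrix'_comp, ← LinearMap.toMatrix'_id]
    congr 1
    ext1
    simp
  · rw [← LinearMap.toMatrix'_comp, ← LinearMap.toMatrix'_id]
    congr 1
    ext1
    simp
  · rw [LinearMap.toMatrix'_mulVec]
    rfl

namespace HolomorphicContraction

variable {n : ℕ} (γ : HolomorphicContraction n)

theorem fderiv_comp_fderiv_inv :
    (fderiv ℂ γ.toFun 0).comp (fderiv ℂ γ.invFun 0) = ContinuousLinearMap.id ℂ _ := by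
  have h0 : γ.invFun 0 = 0 := by
    have := γ.left_inv 0
    rwa [γ.isContraction.apply_eq] at this
  have h1 : HasFDerivAt γ.toFun (fderiv ℂ γ.toFun 0) (γ.invFun 0) := by
    rw [h0]; exact (γ.contDiff_toFun.differentiable (by simp) 0).hasFDerivAt
  have h2 := h1.comp 0 (γ.contDiff_invFun.differentiable (by simp) 0).hasFDerivAt
  have h3 : γ.toFun ∘ γ.invFun = id := funext γ.right_inv
  rw [h3] at h2
  exact h2.unique (hasFDerivAt_id 0)

theorem fderiv_inv_comp_fderiv :
    (fderiv ℂ γ.invFun 0).comp (fderiv ℂ γ.toFun 0) = ContinuousLinearMap.id ℂ _ := by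
  have h1 : HasFDerivAt γ.invFun (fderiv ℂ γ.invFun 0) (γ.toFun 0) := by
    rw [γ.isContraction.apply_eq]
    exact (γ.contDiff_invFun.differentiable (by simp) 0).hasFDerivAt
  have h2 := h1.comp 0 (γ.contDiff_toFun.differentiable (by simp) 0).hasFDerivAt
  have h3 : γ.invFun ∘ γ.toFun = id := funext γ.left_inv
  rw [h3] at h2
  exact h2.unique (hasFDerivAt_id 0)

/-- The differential of a holomorphic contraction at its center. -/
noncomputable def linearPart : (Fin n → ℂ) ≃L[ℂ] (Fin n → ℂ) :=
  ContinuousLinearEquiv.equivOfInverse (fderiv ℂ γ.toFun 0) (fderiv ℂ γ.invFun 0)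
    (fun x => congrArg (fun T : (Fin n → ℂ) →L[ℂ] (Fin n → ℂ) => T x) γ.fderiv_inv_comp_fderiv)
    (fun x => congrArg (fun T : (Fin n → ℂ) →L[ℂ] (Fin n → ℂ) => T x) γ.fderiv_comp_fderiv_inv)

/-- A germ of a biholomorphic linearization extends to a global linearization. -/
theorem exists_global_linearization {F : (Fin n → ℂ) → (Fin n → ℂ)} (hF0 : F 0 = 0)
    (hF : ContDiffAt ℂ ω F 0) (hF' : HasFDerivAt F (ContinuousLinearMap.id ℂ (Fin n → ℂ)) 0)
    (hFγ : ∀ᶠ x in 𝓝 0, F (γ.toFun x) = γ.linearPart (F x)) :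
    ∃ (A : GL (Fin n) ℂ) (δ : HolomorphicContraction n) (Φ : (Fin n → ℂ) ≃ (Fin n → ℂ)),
      (∀ z, δ.toFun z = (A : Matrix (Fin n) (Fin n) ℂ).mulVec z) ∧
      ContDiff ℂ ω Φ ∧ ContDiff ℂ ω Φ.symm ∧ Φ 0 = 0 ∧ ∀ x, Φ (γ.toFun x) = δ.toFun (Φ x) := by
  have hF'' : HasFDerivAt F
      ((ContinuousLinearEquiv.refl ℂ (Fin n → ℂ) : (Fin n → ℂ) →L[ℂ] (Fin n → ℂ))) 0 := hF'
  have hω : (ω : WithTop ℕ∞) ≠ 0 := by simp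
  set e := hF.toOpenPartialHomeomorph F hF'' hω with he
  have heF : (e : (Fin n → ℂ) → (Fin n → ℂ)) = F := hF.toOpenPartialHomeomorph_coe hF'' hω
  have h0s : (0 : Fin n → ℂ) ∈ e.source := hF.mem_toOpenPartialHomeomorph_source hF'' hω
  have h0t : (0 : Fin n → ℂ) ∈ e.target := by
    have := e.map_source h0s
    rwa [heF, hF0] at this
  have hesymm0 : e.symm 0 = 0 := by
    have := e.left_inv h0s
    rwa [heF, hF0] at this
  have hFopen : Filter.map F (𝓝 0) = 𝓝 0 := by
    have := e.map_nhds_eq h0s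
    rwa [heF, hF0] at this
  have hL : ContDiffAt ℂ ω e.symm 0 := by
    have := hF.to_localInverse hF'' hω
    rwa [hF0] at this
  obtain ⟨A, hA⟩ := γ.linearPart.exists_generalLinearGroup
  let δ : HolomorphicContraction n :=
    { toEquiv := γ.linearPart.toEquiv
      contDiff_toFun := γ.linearPart.contDiff
      contDiff_invFun := γ.linearPart.symm.contDiff
      isContraction := γ.isContractionCenteredAt_of_conj
        (A := (γ.linearPart : (Fin n → ℂ) →L[ℂ] (Fin n → ℂ))) hF0 hF.continuousAt hFopen.ge hFγ }
  have hγ0 : Filter.Tendsto γ.toFun (𝓝 0) (𝓝 0) := by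
    have := γ.isContraction.continuous.tendsto 0
    rwa [γ.isContraction.apply_eq] at this
  have hLc : Filter.Tendsto e.symm (𝓝 0) (𝓝 0) := by
    have := hL.continuousAt.tendsto
    rwa [hesymm0] at this
  -- The local inverse of `F` is an equivariant germ in the opposite direction. Both germs extend
  -- globally, and each composite is equivariant and the identity near `0`, hence the identity.
  have hLγ : ∀ᶠ w in 𝓝 0, e.symm (δ.toFun w) = γ.toFun (e.symm w) := by
    filter_upwards [hLc.eventually hFγ, hLc.eventually (hγ0.eventually (e.open_source.mem_nhds h0s)),
      e.open_target.mem_nhds h0t] with w hw1 hw2 hw3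
    have h1 : F (e.symm w) = w := by
      have := e.right_inv hw3
      rwa [heF] at this
    have h2 := e.left_inv hw2
    rw [heF, hw1, h1] at h2
    exact h2
  obtain ⟨Φ, hΦ, hΦγ, hΦF⟩ := γ.exists_equivariant_extension δ.toEquiv δ.contDiff_invFun
    (hF.eventually (by simp)) hFγ
  obtain ⟨Ψ, hΨ, hΨγ, hΨF⟩ := δ.exists_equivariant_extension γ.toEquiv γ.contDiff_invFun
    (hL.eventually (by simp)) hLγ
  have hFc : Filter.Tendsto F (𝓝 0) (𝓝 0) := by
    have := hF.continuousAt.tendsto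
    rwa [hF0] at this
  have hΨΦ : ∀ x, Ψ (Φ x) = x := by
    refine γ.eq_id_of_equivariant (Φ := Ψ ∘ Φ) (fun x => ?_) ?_
    · change Ψ (Φ (γ.toFun x)) = _
      rw [hΦγ]
      exact hΨγ _
    · filter_upwards [hΦF, hFc.eventually hΨF, e.open_source.mem_nhds h0s] with x h1 h2 h3
      change Ψ (Φ x) = x
      rw [h1, h2]
      have := e.left_inv h3
      rwa [heF] at this
  have hΦΨ : ∀ x, Φ (Ψ x) = x := by
    refine δ.eq_id_of_equivariant (Φ := Φ ∘ Ψ) (fun x => ?_) ?_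
    · change Φ (Ψ (δ.toFun x)) = _
      rw [hΨγ]
      exact hΦγ _
    · filter_upwards [hΨF, hLc.eventually hΦF, e.open_target.mem_nhds h0t] with x h1 h2 h3
      change Φ (Ψ x) = x
      rw [h1, h2]
      have := e.right_inv h3
      rwa [heF] at this
  exact ⟨A, δ, ⟨Φ, Ψ, hΨΦ, hΦΨ⟩, hA, hΦ, hΨ, hΦF.self_of_nhds.trans hF0, hΦγ⟩

/-- A holomorphic contraction preserving a flat torsion-free holomorphic connection on `ℂⁿ` is
linear in flat coordinates near its center. -/
theorem exists_local_linearization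
    {Γ : (Fin n → ℂ) → (Fin n → ℂ) →L[ℂ] (Fin n → ℂ) →L[ℂ] (Fin n → ℂ)}
    (hΓ : Differentiable ℂ Γ) (hsymm : ∀ x u v, Γ x u v = Γ x v u)
    (hflat : ∀ x u v w, fderiv ℂ Γ x u v w - fderiv ℂ Γ x v u w + Γ x u (Γ x v w)
      - Γ x v (Γ x u w) = 0)
    (hinv : ∀ x u v, Γ (γ.toFun x) (fderiv ℂ γ.toFun x u) (fderiv ℂ γ.toFun x v)
      + fderiv ℂ (fderiv ℂ γ.toFun) x u v = fderiv ℂ γ.toFun x (Γ x u v)) :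
    ∃ F : (Fin n → ℂ) → (Fin n → ℂ), F 0 = 0 ∧ ContDiffAt ℂ ω F 0 ∧
      HasFDerivAt F (ContinuousLinearMap.id ℂ (Fin n → ℂ)) 0 ∧
      ∀ᶠ x in 𝓝 0, F (γ.toFun x) = γ.linearPart (F x) := by
  -- The equation `dG = G Γ` makes `G` a coframe of parallel one-forms.
  obtain ⟨r, hr, G, hG0, hG⟩ := exists_parallel_of_flat (𝔸 := (Fin n → ℂ) →L[ℂ] (Fin n → ℂ)) hΓ
    (fun x u v => by
      ext1 w
      exact hflat x u v w)
  -- Symmetry of `Γ` says that the one-form `G` is closed, so on a ball it has a primitive.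
  obtain ⟨f, hf⟩ := (convex_ball (0 : Fin n → ℂ) r).exists_forall_hasFDerivAt_of_fderiv_symmetric
    (𝕜 := ℂ) Metric.isOpen_ball
    (fun x hx => ((hG x hx).differentiableAt.restrictScalars ℝ).differentiableWithinAt)
    (fun x hx u v => by
      rw [((hG x hx).restrictScalars ℝ).fderiv]
      exact congrArg (G x) (hsymm x u v))
  set F : (Fin n → ℂ) → (Fin n → ℂ) := fun x => f x - f 0 with hFdef
  have hF0 : F 0 = 0 := sub_self _
  have hF {x : Fin n → ℂ} (hx : x ∈ Metric.ball 0 r) : HasFDerivAt F (G x) x :=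
    (hf x hx).sub_const _
  have h0r : (0 : Fin n → ℂ) ∈ Metric.ball 0 r := Metric.mem_ball_self hr
  have hFd : DifferentiableOn ℂ F (Metric.ball 0 r) := fun x hx =>
    (hF hx).differentiableAt.differentiableWithinAt
  have hγc := γ.isContraction.continuous
  have hγd (x : Fin n → ℂ) : HasFDerivAt γ.toFun (fderiv ℂ γ.toFun x) x :=
    (γ.contDiff_toFun.differentiable (by simp) x).hasFDerivAt
  have hγd2 (x : Fin n → ℂ) :
      HasFDerivAt (fderiv ℂ γ.toFun) (fderiv ℂ (fderiv ℂ γ.toFun) x) x :=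
    ((γ.contDiff_toFun.fderiv_right (m := 1) (by simp)).differentiable (by simp) x).hasFDerivAt
  obtain ⟨s, hs, hsr⟩ := Metric.nhds_basis_ball.mem_iff.1
    (Filter.inter_mem (Metric.ball_mem_nhds 0 hr) (hγc.continuousAt.preimage_mem_nhds
      (x := 0) (by rw [γ.isContraction.apply_eq]; exact Metric.ball_mem_nhds 0 hr)))
  set B := (γ.linearPart.symm : (Fin n → ℂ) →L[ℂ] (Fin n → ℂ)) with hB
  -- The pullback of the coframe by `γ`, normalized by the inverse of `dγ₀` to take the value `1` at
  -- the origin. Invariance of `Γ` makes it parallel, so it equals `G`.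
  set G₂ : (Fin n → ℂ) → (Fin n → ℂ) →L[ℂ] (Fin n → ℂ) := fun x =>
    B.comp ((G (γ.toFun x)).comp (fderiv ℂ γ.toFun x)) with hG₂
  have hG₂0 : G 0 = G₂ 0 := by
    ext1 v
    rw [hG₂]
    dsimp only
    rw [γ.isContraction.apply_eq, hG0]
    exact (γ.linearPart.symm_apply_apply v).symm
  have hG₂d : ∀ x ∈ Metric.ball 0 s, HasFDerivAt G₂ (mulForm G₂ Γ x) x := by
    intro x hx
    have h1 := ((hG _ (hsr hx).2).comp x (hγd x)).clm_comp (hγd2 x)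
    have h2 := (hasFDerivAt_const B x).clm_comp h1
    refine h2.congr_fderiv ?_
    ext1 v
    ext1 w
    have h3 := congrArg (fun z => B (G (γ.toFun x) z)) (hinv x v w)
    simp only [map_add] at h3
    rw [mulForm_apply]
    change _ = B (G (γ.toFun x) (fderiv ℂ γ.toFun x (Γ x v w)))
    rw [← h3]
    simp [add_comm]
  have hGG := parallel_unique hΓ hG₂0 (fun x hx => hG x (hsr hx).1) hG₂d
  refine ⟨F, hF0, (hFd.contDiffOn_pi Metric.isOpen_ball).contDiffAt (Metric.ball_mem_nhds 0 hr),
    ?_, ?_⟩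
  · have := hF h0r
    rwa [hG0] at this
  -- The equality of the two coframes says that `F ∘ γ` and `dγ₀ ∘ F` have the same derivative; they
  -- agree at `0`.
  · have hd : ∀ x ∈ Metric.ball (0 : Fin n → ℂ) s,
        HasFDerivAt (fun x => F (γ.toFun x) - γ.linearPart (F x))
          (0 : (Fin n → ℂ) →L[ℂ] (Fin n → ℂ)) x := by
      intro x hx
      have h1 := (hF (hsr hx).2).comp x (hγd x)
      have h2 := (γ.linearPart : (Fin n → ℂ) →L[ℂ] (Fin n → ℂ)).hasFDerivAt.comp x (hF (hsr hx).1)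
      refine (h1.sub h2).congr_fderiv ?_
      rw [hGG hx, sub_eq_zero]
      ext1 v
      exact (γ.linearPart.apply_symm_apply _).symm
    filter_upwards [Metric.ball_mem_nhds (0 : Fin n → ℂ) hs] with x hx
    have := Metric.isOpen_ball.is_const_of_fderiv_eq_zero (𝕜 := ℂ)
      (convex_ball (0 : Fin n → ℂ) s).isPreconnected
      (fun x hx => (hd x hx).differentiableAt.differentiableWithinAt)
      (fun x hx => (hd x hx).fderiv) hx (Metric.mem_ball_self hs)
    rw [γ.isContraction.apply_eq, hF0, map_zero, sub_zero, sub_eq_zero] at this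
    exact this

end HolomorphicContraction

/-! ### Maps between Hopf manifolds induced by conjugacies -/

namespace HopfManifold

variable {n : ℕ} (γ : HolomorphicContraction n)

theorem proj_apply_chart {φ : OpenPartialHomeomorph (HopfManifold γ) (Fin n → ℂ)}
    (hφ : φ ∈ charts γ) {b : Fin n → ℂ} (hb : b ∈ φ.target) :
    ∃ hz : b ≠ 0, proj γ ⟨b, hz⟩ = φ.symm b := by
  obtain ⟨hz, h⟩ := hφ _ (φ.map_target hb)
  have hb' : φ (φ.symm b) = b := φ.right_inv hb
  exact ⟨fun h0 => hz (hb'.trans h0), (congrArg (proj γ) (Subtype.ext hb'.symm)).trans h⟩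

/-- Every point of `ℂⁿ ∖ 0` is the value of a chart. -/
theorem exists_chart_target {z : Fin n → ℂ} (hz : z ≠ 0) :
    ∃ φ ∈ charts γ, z ∈ φ.target ∧ φ.symm z = proj γ ⟨z, hz⟩ := by
  obtain ⟨e, hze, he⟩ := (isQuotientCoveringMap_proj γ).isCoveringMap.isLocalHomeomorph ⟨z, hz⟩
  have : Nonempty (PuncturedSpace n) := ⟨⟨z, hz⟩⟩
  have ho : IsOpenEmbedding (Subtype.val : PuncturedSpace n → (Fin n → ℂ)) :=
    (isOpen_ne (x := (0 : Fin n → ℂ))).isOpenEmbedding_subtypeVal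
  set φ := e.symm.trans ho.toOpenPartialHomeomorph with hφdef
  have hφ : φ ∈ charts γ := by
    intro h hh
    have hh' : h ∈ e.target := by simpa [hφdef] using hh
    refine ⟨(e.symm h).2, ?_⟩
    change proj γ (e.symm h) = h
    rw [he]
    exact e.right_inv hh'
  have hs : proj γ ⟨z, hz⟩ ∈ φ.source := by
    rw [he]
    simpa [hφdef] using e.map_source hze
  have hv : φ (proj γ ⟨z, hz⟩) = z := by
    change (e.symm (proj γ ⟨z, hz⟩) : Fin n → ℂ) = z
    rw [he, e.left_inv hze]
  exact ⟨φ, hφ, hv ▸ φ.map_source hs, by rw [← φ.left_inv hs, hv]⟩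

variable {γ}

/-- The map of Hopf manifolds induced by an equivariant bijection. -/
def map {δ : HolomorphicContraction n} (Φ : (Fin n → ℂ) ≃ (Fin n → ℂ)) (h0 : Φ 0 = 0)
    (h : ∀ x, Φ (γ.toFun x) = δ.toFun (Φ x)) : HopfManifold γ → HopfManifold δ :=
  Quotient.lift
    (fun z : PuncturedSpace n =>
      proj δ ⟨Φ z, fun hz => z.2 (Φ.injective (hz.trans h0.symm))⟩)
    (by
      intro z w hzw
      have hne (z : PuncturedSpace n) : Φ z ≠ 0 := fun hz => z.2 (Φ.injective (hz.trans h0.symm))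
      -- Only nonnegative powers need the computation; a negative power is handled by exchanging `z`
      -- and `w`.
      have key (m : ℕ) (z w : PuncturedSpace n) (hm : (γ.punctured ^ m) w = z) :
          (δ.punctured ^ m) ⟨Φ w, hne w⟩ = ⟨Φ z, hne z⟩ := by
        refine Subtype.ext ?_
        subst hm
        rw [δ.pow_val]
        change _ = Φ ((γ.punctured ^ m) w : PuncturedSpace n)
        rw [γ.pow_val]
        have h2 : Function.Semiconj Φ γ.toFun δ.toFun := h
        exact ((h2.iterate_right m).eq _).symm
      obtain ⟨k, hk⟩ := (proj_eq_iff γ).1 (Quotient.sound hzw : proj γ z = proj γ w)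
      refine (proj_eq_iff δ).2 ⟨k, ?_⟩
      obtain ⟨m, rfl | rfl⟩ := k.eq_nat_or_neg
      · rw [zpow_natCast] at hk ⊢
        exact key m z w hk
      · rw [zpow_neg, zpow_natCast, Equiv.Perm.inv_eq_iff_eq] at hk ⊢
        exact (key m w z hk.symm).symm)

theorem map_proj {δ : HolomorphicContraction n} (Φ : (Fin n → ℂ) ≃ (Fin n → ℂ)) (h0 : Φ 0 = 0)
    (h : ∀ x, Φ (γ.toFun x) = δ.toFun (Φ x)) (z : PuncturedSpace n) :
    map Φ h0 h (proj γ z) =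
      proj δ ⟨Φ z, fun hz => z.2 (Φ.injective (hz.trans h0.symm))⟩ := rfl

theorem contMDiff_map {δ : HolomorphicContraction n} (Φ : (Fin n → ℂ) ≃ (Fin n → ℂ))
    (hΦ : ContDiff ℂ ω Φ) (h0 : Φ 0 = 0) (h : ∀ x, Φ (γ.toFun x) = δ.toFun (Φ x)) :
    ContMDiff 𝓘(ℂ, Fin n → ℂ) 𝓘(ℂ, Fin n → ℂ) ω (map Φ h0 h) := by
  intro x
  obtain ⟨z, rfl⟩ := (isQuotientCoveringMap_proj γ).surjective x
  have hΦz : Φ z ≠ 0 := fun hz => z.2 (Φ.injective (hz.trans h0.symm))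
  obtain ⟨φ, hφ, hzφ, hφz⟩ := exists_chart_target γ z.2
  obtain ⟨ψ, hψ, hzψ, hψz⟩ := exists_chart_target δ hΦz
  have hxs : proj γ z ∈ φ.source := by
    have := φ.map_target hzφ
    rwa [hφz] at this
  have hφx : φ (proj γ z) = z := by
    have := φ.right_inv hzφ
    rwa [hφz] at this
  have hfs : map Φ h0 h (proj γ z) ∈ ψ.source := by
    rw [map_proj, ← hψz]
    exact ψ.map_target hzψ
  -- the coordinate expression of the map is `Φ`
  have hcoord {b : Fin n → ℂ} (hb : b ∈ φ.target) (hb' : Φ b ∈ ψ.target) :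
      map Φ h0 h (φ.symm b) = ψ.symm (Φ b) := by
    obtain ⟨hb0, hb1⟩ := proj_apply_chart γ hφ hb
    obtain ⟨hc0, hc1⟩ := proj_apply_chart δ hψ hb'
    rw [← hb1, ← hc1, map_proj]
  have hev : ∀ᶠ b in 𝓝 (z : Fin n → ℂ), b ∈ φ.target ∧ Φ b ∈ ψ.target :=
    Filter.Eventually.and (φ.open_target.mem_nhds hzφ)
      (hΦ.continuous.continuousAt.preimage_mem_nhds (ψ.open_target.mem_nhds hzψ))
  have hφm : φ ∈ IsManifold.maximalAtlas 𝓘(ℂ, Fin n → ℂ) ω (HopfManifold γ) :=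
    IsManifold.subset_maximalAtlas hφ
  have hψm : ψ ∈ IsManifold.maximalAtlas 𝓘(ℂ, Fin n → ℂ) ω (HopfManifold δ) :=
    IsManifold.subset_maximalAtlas hψ
  rw [contMDiffAt_iff_of_mem_maximalAtlas hφm hψm hxs hfs]
  constructor
  · have h1 : ContinuousAt (fun y => ψ.symm (Φ (φ y))) (proj γ z) := by
      refine ContinuousAt.comp (g := ψ.symm) ?_
        (hΦ.continuous.continuousAt.comp (φ.continuousAt hxs))
      rw [hφx]
      exact ψ.continuousAt_symm hzψ
    refine h1.congr ?_
    filter_upwards [φ.open_source.mem_nhds hxs,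
      (φ.continuousAt hxs).tendsto.eventually (hφx.symm ▸ hev)] with y hy1 hy2
    rw [← hcoord hy2.1 hy2.2, φ.left_inv hy1]
  · refine ContDiffAt.contDiffWithinAt ?_
    refine hΦ.contDiffAt.congr_of_eventuallyEq ?_
    have hφx' : (φ.extend 𝓘(ℂ, Fin n → ℂ)) (proj γ z) = z := by simpa using hφx
    rw [hφx']
    filter_upwards [hev] with b hb
    have := hcoord hb.1 hb.2
    simp [this, ψ.right_inv hb.2]

/-- Hopf manifolds of conjugate contractions are biholomorphic. -/
theorem nonempty_diffeomorph {δ : HolomorphicContraction n} (Φ : (Fin n → ℂ) ≃ (Fin n → ℂ))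
    (hΦ : ContDiff ℂ ω Φ) (hΦ' : ContDiff ℂ ω Φ.symm) (h0 : Φ 0 = 0)
    (h : ∀ x, Φ (γ.toFun x) = δ.toFun (Φ x)) :
    Nonempty (HopfManifold γ ≃ₘ^ω⟮𝓘(ℂ, Fin n → ℂ), 𝓘(ℂ, Fin n → ℂ)⟯ HopfManifold δ) := by
  have h0' : Φ.symm 0 = 0 := by rw [Equiv.symm_apply_eq, h0]
  have h' (x : Fin n → ℂ) : Φ.symm (δ.toFun x) = γ.toFun (Φ.symm x) := by
    rw [Equiv.symm_apply_eq, h, Equiv.apply_symm_apply]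
  refine ⟨⟨⟨map Φ h0 h, map Φ.symm h0' h', fun x => ?_, fun x => ?_⟩,
    contMDiff_map Φ hΦ h0 h, contMDiff_map Φ.symm hΦ' h0' h'⟩⟩
  · obtain ⟨z, rfl⟩ := (isQuotientCoveringMap_proj γ).surjective x
    rw [map_proj, map_proj]
    exact congrArg (proj γ) (Subtype.ext (Φ.symm_apply_apply z))
  · obtain ⟨z, rfl⟩ := (isQuotientCoveringMap_proj δ).surjective x
    rw [map_proj, map_proj]
    exact congrArg (proj δ) (Subtype.ext (Φ.apply_symm_apply z))

end HopfManifold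

/-! ### Dimension at most one -/

/-- An entire automorphism of `ℂ` fixing the origin is linear. -/
theorem exists_eq_mul_of_entire_equiv (f : ℂ ≃ ℂ) (hf : Differentiable ℂ f)
    (hf' : Differentiable ℂ f.symm) (h0 : f 0 = 0) : ∃ c, ∀ z, f z = c * z := by
  -- inversion at infinity
  have key (g : ℂ ≃ ℂ) (hg : Differentiable ℂ g) (hg' : Differentiable ℂ g.symm) (hg0 : g 0 = 0) :
      Differentiable ℂ fun w => (g w⁻¹)⁻¹ := by
    have hne {w : ℂ} (hw : w ≠ 0) : g w⁻¹ ≠ 0 := fun h =>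
      inv_ne_zero hw (g.injective (h.trans hg0.symm))
    rw [← differentiableOn_univ, ← Complex.differentiableOn_compl_singleton_and_continuousAt_iff
      (c := 0) Filter.univ_mem]
    constructor
    · intro w hw
      have hw0 : w ≠ 0 := hw.2
      exact (((hg _).comp w (differentiableAt_inv hw0)).inv (hne hw0)).differentiableWithinAt
    -- A homeomorphism of `ℂ` is proper, so `1 / g(1/w)` tends to `0` as `w` tends to `0` and the
    -- singularity is removable.
    · have h1 : Filter.Tendsto g (Filter.cocompact ℂ) (Filter.cocompact ℂ) :=
        (Homeomorph.mk g hg.continuous hg'.continuous).isClosedEmbedding.tendsto_cocompact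
      have h2 : Filter.Tendsto (fun w => (g w⁻¹)⁻¹) (𝓝[≠] 0) (𝓝 0) :=
        (Filter.tendsto_inv₀_cobounded (α := ℂ)).comp
          ((Metric.cobounded_eq_cocompact (α := ℂ)) ▸ (h1.comp
            (Metric.cobounded_eq_cocompact (α := ℂ) ▸ Filter.tendsto_inv₀_nhdsNE_zero (α := ℂ))))
      rw [continuousAt_iff_punctured_nhds]
      simpa [hg0] using h2
  set u : ℂ → ℂ := fun w => (f w⁻¹)⁻¹ with hu
  set v : ℂ → ℂ := fun w => (f.symm w⁻¹)⁻¹ with hv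
  have hf0' : f.symm 0 = 0 := by rw [Equiv.symm_apply_eq, h0]
  have hud : Differentiable ℂ u := key f hf hf' h0
  have hvd : Differentiable ℂ v := key f.symm hf' hf hf0'
  have hu0 : u 0 = 0 := by simp [hu, h0]
  have huv : v ∘ u = id := by
    funext w; simp [hu, hv]
  have hder : deriv v 0 * deriv u 0 = 1 := by
    have h1 : HasDerivAt v (deriv v 0) (u 0) := by rw [hu0]; exact (hvd 0).hasDerivAt
    have h2 := h1.comp 0 (hud 0).hasDerivAt
    rw [huv] at h2
    exact h2.unique (hasDerivAt_id 0)
  have hu' : deriv u 0 ≠ 0 := right_ne_zero_of_mul_eq_one hder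
  -- With `w = 1/z` one has `f(z)/z = (u(w)/w)⁻¹`, which has the finite limit `u'(0)⁻¹` at infinity.
  -- The entire function `f(z)/z` is then constant by Liouville.
  have hslope : Filter.Tendsto (dslope f 0) (Filter.cocompact ℂ) (𝓝 (deriv u 0)⁻¹) := by
    have h1 : Filter.Tendsto (fun w => (slope u 0 w)⁻¹) (𝓝[≠] 0) (𝓝 (deriv u 0)⁻¹) :=
      (hasDerivAt_iff_tendsto_slope.1 (hud 0).hasDerivAt).inv₀ hu'
    have h2 := h1.comp (Filter.tendsto_inv₀_cobounded' (α := ℂ))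
    rw [Metric.cobounded_eq_cocompact] at h2
    refine h2.congr' ?_
    have h3 : ∀ᶠ z in Filter.cocompact ℂ, z ≠ 0 := by
      filter_upwards [(isCompact_singleton (x := (0 : ℂ))).compl_mem_cocompact] with z hz
      exact hz
    filter_upwards [h3] with z hz
    rw [dslope_of_ne _ hz, Function.comp_apply, slope_def_field, slope_def_field, hu0, h0]
    simp only [hu, sub_zero, inv_inv]
    field_simp
  have hds : Differentiable ℂ (dslope f 0) := by
    rw [← differentiableOn_univ, Complex.differentiableOn_dslope Filter.univ_mem]
    exact hf.differentiableOn
  refine ⟨(deriv u 0)⁻¹, fun z => ?_⟩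
  have h1 := hds.apply_eq_of_tendsto_cocompact z hslope
  have h2 := sub_smul_dslope f 0 z
  rw [h1, h0, sub_zero, sub_zero, smul_eq_mul] at h2
  rw [← h2, mul_comm]

/-- Settles the dimensions outside the range of Hartogs: the contraction is already linear. -/
theorem HolomorphicContraction.exists_generalLinearGroup_of_le_one {n : ℕ} (hn : n ≤ 1)
    (γ : HolomorphicContraction n) : ∃ A : GL (Fin n) ℂ,
      ∀ z : Fin n → ℂ, γ.toFun z = (A : Matrix (Fin n) (Fin n) ℂ).mulVec z := by
  suffices ∃ B : (Fin n → ℂ) →L[ℂ] (Fin n → ℂ), ∀ z, γ.toFun z = B z by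
    obtain ⟨B, hB⟩ := this
    obtain ⟨A, hA⟩ := γ.linearPart.exists_generalLinearGroup
    refine ⟨A, fun z => ?_⟩
    have h1 : γ.toFun = B := funext hB
    have h2 : γ.linearPart z = fderiv ℂ γ.toFun 0 z := rfl
    rw [← hA, h2, h1, B.fderiv]
  obtain rfl | rfl : n = 0 ∨ n = 1 := by omega
  · exact ⟨0, fun z => Subsingleton.elim _ _⟩
  · let p := ContinuousLinearEquiv.funUnique (Fin 1) ℂ ℂ
    let f : ℂ ≃ ℂ := (p.symm.toEquiv.trans γ.toEquiv).trans p.toEquiv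
    obtain ⟨c, hc⟩ := exists_eq_mul_of_entire_equiv f
      (p.differentiable.comp ((γ.contDiff_toFun.differentiable (by simp)).comp
        p.symm.differentiable))
      (p.differentiable.comp ((γ.contDiff_invFun.differentiable (by simp)).comp
        p.symm.differentiable))
      (by
        change p (γ.toFun (p.symm 0)) = 0
        rw [map_zero, γ.isContraction.apply_eq, map_zero])
    refine ⟨c • ContinuousLinearMap.id ℂ _, fun z => p.injective ?_⟩
    have h1 := hc (p z)
    change p (γ.toFun (p.symm (p z))) = _ at h1
    rw [p.symm_apply_apply] at h1
    rw [h1]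
    simp

/-! ### Vector fields given by their expression in a chart -/

section ChartFields

variable {𝕜 : Type*} [RCLike 𝕜] {E : Type*} [NormedAddCommGroup E] [NormedSpace 𝕜 E]
  {M : Type*} [TopologicalSpace M] [ChartedSpace E M]

theorem mdifferentiableAt_vectorField_iff {s : Π x : E, TangentSpace 𝓘(𝕜, E) x} {a : E} :
    MDifferentiableAt 𝓘(𝕜, E) (𝓘(𝕜, E).prod 𝓘(𝕜, E))
      (fun x => (⟨x, s x⟩ : TotalSpace E (TangentSpace 𝓘(𝕜, E) : E → Type _))) a ↔
      DifferentiableAt 𝕜 (s : E → E) a := by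
  refine (mdifferentiableAt_section (F := E) 𝓘(𝕜, E) s).trans ?_
  refine Iff.trans (Iff.of_eq ?_) mdifferentiableAt_iff_differentiableAt
  congr 1
  ext x
  simp
  rfl

variable (𝕜) in
/-- The vector field on a manifold whose expression in the chart `φ` is `s`. -/
noncomputable def chartField (φ : OpenPartialHomeomorph M E) (s : E → E) :
    Π x : M, TangentSpace 𝓘(𝕜, E) x :=
  VectorField.mpullback 𝓘(𝕜, E) 𝓘(𝕜, E) φ s

theorem chartField_add (φ : OpenPartialHomeomorph M E) (s t : E → E) :
    chartField 𝕜 φ (s + t) = chartField 𝕜 φ s + chartField 𝕜 φ t :=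
  VectorField.mpullback_add

theorem chartField_smul (φ : OpenPartialHomeomorph M E) (f : E → 𝕜) (s : E → E) :
    chartField 𝕜 φ (f • s) = (f ∘ φ) • chartField 𝕜 φ s :=
  VectorField.mpullback_smul

variable [IsManifold 𝓘(𝕜, E) ω M]

theorem isInvertible_mfderiv_chart {φ : OpenPartialHomeomorph M E} (hφ : φ ∈ atlas E M)
    {x : M} (hx : x ∈ φ.source) : (mfderiv 𝓘(𝕜, E) 𝓘(𝕜, E) φ x).IsInvertible := by
  have : IsManifold 𝓘(𝕜, E) 1 M := IsManifold.of_le (n := ω) (by simp)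
  exact ⟨(mdifferentiable_of_mem_atlas hφ).mfderiv hx, rfl⟩

theorem mfderiv_chartField {φ : OpenPartialHomeomorph M E} (hφ : φ ∈ atlas E M)
    {x : M} (hx : x ∈ φ.source) (s : E → E) :
    mfderiv 𝓘(𝕜, E) 𝓘(𝕜, E) φ x (chartField 𝕜 φ s x) = s (φ x) := by
  exact (isInvertible_mfderiv_chart hφ hx).self_apply_inverse _

variable [CompleteSpace E]

theorem contMDiffAt_chartField {φ : OpenPartialHomeomorph M E} (hφ : φ ∈ atlas E M)
    {x : M} (hx : x ∈ φ.source) {s : E → E} {m : ℕ∞ω} (hs : ContDiffAt 𝕜 m s (φ x)) :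
    ContMDiffAt 𝓘(𝕜, E) (𝓘(𝕜, E).prod 𝓘(𝕜, E)) m
      (fun x => (⟨x, chartField 𝕜 φ s x⟩ :
        TotalSpace E (TangentSpace 𝓘(𝕜, E) : M → Type _))) x := by
  have h : ContMDiffAt 𝓘(𝕜, E) 𝓘(𝕜, E) ω φ x :=
    contMDiffAt_of_mem_maximalAtlas (IsManifold.subset_maximalAtlas hφ) hx
  exact ContMDiffAt.mpullback_vectorField_preimage (n := ω)
    (contMDiffAt_vectorSpace_iff_contDiffAt.2 hs) h (isInvertible_mfderiv_chart hφ hx) (by simp)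

theorem mdifferentiableAt_chartField {φ : OpenPartialHomeomorph M E} (hφ : φ ∈ atlas E M)
    {x : M} (hx : x ∈ φ.source) {s : E → E} (hs : DifferentiableAt 𝕜 s (φ x)) :
    MDifferentiableAt 𝓘(𝕜, E) (𝓘(𝕜, E).prod 𝓘(𝕜, E))
      (fun x => (⟨x, chartField 𝕜 φ s x⟩ :
        TotalSpace E (TangentSpace 𝓘(𝕜, E) : M → Type _))) x := by
  have h : ContMDiffAt 𝓘(𝕜, E) 𝓘(𝕜, E) ω φ x :=
    contMDiffAt_of_mem_maximalAtlas (IsManifold.subset_maximalAtlas hφ) hx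
  exact MDifferentiableAt.mpullback_vectorField (n := ω)
    (mdifferentiableAt_vectorField_iff.2 hs) h (isInvertible_mfderiv_chart hφ hx) (by simp)

end ChartFields

/-! ### Christoffel symbols as the difference from the flat connection -/

section ChartConnection

variable {E : Type*} [NormedAddCommGroup E] [NormedSpace ℝ E]
  {M : Type*} [TopologicalSpace M] [ChartedSpace E M] [IsManifold 𝓘(ℝ, E) ω M]

/-- The expression in the chart `φ` of a connection on the tangent bundle. -/
noncomputable def chartConnection
    (nabla : CovariantDerivative 𝓘(ℝ, E) E (fun x : M => TangentSpace 𝓘(ℝ, E) x))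
    (φ : OpenPartialHomeomorph M E) (s : E → E) (a : E) : E →L[ℝ] E :=
  (mfderiv 𝓘(ℝ, E) 𝓘(ℝ, E) φ (φ.symm a) : TangentSpace 𝓘(ℝ, E) (φ.symm a) →L[ℝ] E) ∘L
    nabla (chartField ℝ φ s) (φ.symm a) ∘L
    (mfderiv 𝓘(ℝ, E) 𝓘(ℝ, E) φ (φ.symm a) : TangentSpace 𝓘(ℝ, E) (φ.symm a) →L[ℝ] E).inverse

theorem chartConnection_apply
    (nabla : CovariantDerivative 𝓘(ℝ, E) E (fun x : M => TangentSpace 𝓘(ℝ, E) x))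
    {φ : OpenPartialHomeomorph M E} {x : M} (hx : x ∈ φ.source) (s : E → E) (u : E) :
    chartConnection nabla φ s (φ x) u = (mfderiv 𝓘(ℝ, E) 𝓘(ℝ, E) φ x
      (nabla (chartField ℝ φ s) x (chartField ℝ φ (fun _ => u) x)) : E) := by
  -- The tangent space depends on the base point, and `φ.symm (φ x)` equals `x` only
  -- propositionally; the point is generalized before substituting.
  have h (y : M) (hy : y = x) :
    ((mfderiv 𝓘(ℝ, E) 𝓘(ℝ, E) φ y : TangentSpace 𝓘(ℝ, E) y →L[ℝ] E) ∘L
    nabla (chartField ℝ φ s) y ∘L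
    (mfderiv 𝓘(ℝ, E) 𝓘(ℝ, E) φ y : TangentSpace 𝓘(ℝ, E) y →L[ℝ] E).inverse) u =
     (mfderiv 𝓘(ℝ, E) 𝓘(ℝ, E) φ x
      (nabla (chartField ℝ φ s) x (chartField ℝ φ (fun _ => u) x)) : E) := by
    subst hy; rfl
  exact h _ (φ.left_inv hx)

/-- The reference connection: subtracting it from the chart expression of `∇` leaves a tensor, the
Christoffel symbols. -/
theorem isCovariantDerivativeOn_fderiv (U : Set E) :
    IsCovariantDerivativeOn (I := 𝓘(ℝ, E)) E (V := (TangentSpace 𝓘(ℝ, E) : E → Type _))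
      (fun s : E → E => fderiv ℝ s) U where
  add {s t a} hs ht ha :=
    fderiv_add (mdifferentiableAt_vectorField_iff.1 hs) (mdifferentiableAt_vectorField_iff.1 ht)
  leibniz {s g a} hs hg ha := by
    have h := fderiv_smul (mdifferentiableAt_iff_differentiableAt.1 hg)
      (mdifferentiableAt_vectorField_iff.1 hs)
    rw [← mfderiv_eq_fderiv (f := g)] at h
    exact h

variable [CompleteSpace E]
  (nabla : CovariantDerivative 𝓘(ℝ, E) E (fun x : M => TangentSpace 𝓘(ℝ, E) x))
  {φ : OpenPartialHomeomorph M E}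

theorem chartConnection_add (hφ : φ ∈ atlas E M) {s t : E → E} {a : E} (ha : a ∈ φ.target)
    (hs : DifferentiableAt ℝ s a)
    (ht : DifferentiableAt ℝ t a) :
    chartConnection nabla φ (s + t) a =
      chartConnection nabla φ s a + chartConnection nabla φ t a := by
  obtain ⟨x, hx, rfl⟩ : ∃ x ∈ φ.source, φ x = a := ⟨_, φ.map_target ha, φ.right_inv ha⟩
  ext u
  rw [add_apply, chartConnection_apply _ hx, chartConnection_apply _ hx,
    chartConnection_apply _ hx, chartField_add, nabla.isCovariantDerivativeOnUniv.add
      (mdifferentiableAt_chartField hφ hx hs) (mdifferentiableAt_chartField hφ hx ht)]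
  exact map_add _ _ _

theorem chartConnection_smul (hφ : φ ∈ atlas E M) {f : E → ℝ} {s : E → E} {a : E}
    (ha : a ∈ φ.target)
    (hs : DifferentiableAt ℝ s a) (hf : DifferentiableAt ℝ f a) :
    chartConnection nabla φ (f • s) a =
      f a • chartConnection nabla φ s a + (fderiv ℝ f a).smulRight (s a) := by
  obtain ⟨x, hx, rfl⟩ : ∃ x ∈ φ.source, φ x = a := ⟨_, φ.map_target ha, φ.right_inv ha⟩
  have : IsManifold 𝓘(ℝ, E) 1 M := IsManifold.of_le (n := ω) (by simp)
  have hφd : MDifferentiableAt 𝓘(ℝ, E) 𝓘(ℝ, E) φ x :=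
    (mdifferentiable_of_mem_atlas (I := 𝓘(ℝ, E)) hφ).mdifferentiableAt hx
  have hfφ : HasMFDerivAt 𝓘(ℝ, E) 𝓘(ℝ, ℝ) (f ∘ φ) x
      ((fderiv ℝ f (φ x)) ∘L (mfderiv 𝓘(ℝ, E) 𝓘(ℝ, E) φ x)) :=
    HasMFDerivAt.comp x hf.hasFDerivAt.hasMFDerivAt hφd.hasMFDerivAt
  ext u
  rw [add_apply, chartConnection_apply _ hx, smul_apply,
    chartConnection_apply _ hx, chartField_smul, nabla.isCovariantDerivativeOnUniv.leibniz
      (mdifferentiableAt_chartField hφ hx hs) hfφ.mdifferentiableAt]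
  have h1 : (mfderiv 𝓘(ℝ, E) 𝓘(ℝ, ℝ) (f ∘ φ) x (chartField ℝ φ (fun _ => u) x) : ℝ) =
      fderiv ℝ f (φ x) u := by
    rw [hfφ.mfderiv]
    exact congrArg (fderiv ℝ f (φ x)) (mfderiv_chartField hφ hx (fun _ => u))
  have h2 : (mfderiv 𝓘(ℝ, E) 𝓘(ℝ, E) φ x (chartField ℝ φ s x) : E) = s (φ x) :=
    mfderiv_chartField hφ hx s
  set D : TangentSpace 𝓘(ℝ, E) x →L[ℝ] E := mfderiv 𝓘(ℝ, E) 𝓘(ℝ, E) φ x with hD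
  change D (_ + _) = _
  rw [map_add]
  congr 1
  · exact map_smul D _ _
  · refine (map_smul D _ _).trans ?_
    rw [ContinuousLinearMap.smulRight_apply]
    exact congrArg₂ (· • ·) h1 h2

theorem isCovariantDerivativeOn_chartConnection (hφ : φ ∈ atlas E M) :
    IsCovariantDerivativeOn (I := 𝓘(ℝ, E)) E (V := (TangentSpace 𝓘(ℝ, E) : E → Type _))
      (chartConnection nabla φ) φ.target where
  add {s t a} hs ht ha :=
    chartConnection_add nabla hφ ha (mdifferentiableAt_vectorField_iff.1 hs)
      (mdifferentiableAt_vectorField_iff.1 ht)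
  leibniz {s g a} hs hg ha := by
    have h := chartConnection_smul nabla hφ ha (mdifferentiableAt_vectorField_iff.1 hs)
      (mdifferentiableAt_iff_differentiableAt.1 hg)
    rw [← mfderiv_eq_fderiv] at h
    exact h

variable [FiniteDimensional ℝ E]

/-- The Christoffel symbols of a connection in the chart `φ`. -/
noncomputable def christoffel (hφ : φ ∈ atlas E M) (a : E) : E →L[ℝ] E →L[ℝ] E :=
  -- `difference` takes the value of the section first; after flipping, the first argument is the
  -- direction of differentiation.
  ContinuousLinearMap.flip (IsCovariantDerivativeOn.difference
    (isCovariantDerivativeOn_chartConnection nabla hφ)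
    (isCovariantDerivativeOn_fderiv φ.target) a : E →L[ℝ] E →L[ℝ] E)

theorem chartConnection_eq (hφ : φ ∈ atlas E M) {s : E → E} {a : E} (ha : a ∈ φ.target)
    (hs : DifferentiableAt ℝ s a)
    (u : E) :
    chartConnection nabla φ s a u = fderiv ℝ s a u + christoffel nabla hφ a u (s a) := by
  have h := IsCovariantDerivativeOn.difference_apply
    (isCovariantDerivativeOn_chartConnection nabla hφ)
    (isCovariantDerivativeOn_fderiv φ.target) ha (mdifferentiableAt_vectorField_iff.2 hs)
  have h' : christoffel nabla hφ a u (s a) = chartConnection nabla φ s a u - fderiv ℝ s a u :=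
    congrArg (fun A : E →L[ℝ] E => A u) h
  rw [h']
  abel

end ChartConnection

section ApplyApply

variable {𝕜 : Type*} [NontriviallyNormedField 𝕜] {E F G H : Type*}
  [NormedAddCommGroup E] [NormedSpace 𝕜 E] [NormedAddCommGroup F] [NormedSpace 𝕜 F]
  [NormedAddCommGroup G] [NormedSpace 𝕜 G] [NormedAddCommGroup H] [NormedSpace 𝕜 H]
  {Γ : E → F →L[𝕜] G →L[𝕜] H} {a : E}

theorem differentiableAt_apply_apply (h : DifferentiableAt 𝕜 Γ a) (v : F) (w : G) :
    DifferentiableAt 𝕜 (fun x => Γ x v w) a :=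
  (h.clm_apply (differentiableAt_const v)).clm_apply (differentiableAt_const w)

theorem fderiv_apply_apply (h : DifferentiableAt 𝕜 Γ a) (u : E) (v : F) (w : G) :
    fderiv 𝕜 (fun x => Γ x v w) a u = fderiv 𝕜 Γ a u v w := by
  have h1 := h.hasFDerivAt.clm_apply (hasFDerivAt_const v a)
  have h2 := h1.clm_apply (hasFDerivAt_const w a)
  rw [h2.fderiv]
  simp

end ApplyApply

/-! ### Torsion, smoothness and curvature in coordinates -/

section Christoffel

variable {E : Type*} [NormedAddCommGroup E] [NormedSpace ℝ E]
  {M : Type*} [TopologicalSpace M] [ChartedSpace E M] [IsManifold 𝓘(ℝ, E) ω M]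
  (nabla : CovariantDerivative 𝓘(ℝ, E) E (fun x : M => TangentSpace 𝓘(ℝ, E) x))
  {φ : OpenPartialHomeomorph M E}

theorem eq_of_chartField_eq (hφ : φ ∈ atlas E M) {x : M} (hx : x ∈ φ.source) {s t : E → E}
    (h : chartField ℝ φ s x = chartField ℝ φ t x) : s (φ x) = t (φ x) :=
  (mfderiv_chartField hφ hx s).symm.trans
    ((congrArg (mfderiv 𝓘(ℝ, E) 𝓘(ℝ, E) φ x) h).trans (mfderiv_chartField hφ hx t))

variable [CompleteSpace E]

/-- Pulling the field back along the inverse chart returns its coordinate expression, because the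
derivatives of `φ` and `φ.symm` are mutually inverse. -/
theorem contDiffAt_of_contMDiffAt_chartField (hφ : φ ∈ atlas E M) {x : M} (hx : x ∈ φ.source)
    {s : E → E} {m : ℕ∞ω}
    (hs : ContMDiffAt 𝓘(ℝ, E) (𝓘(ℝ, E).prod 𝓘(ℝ, E)) m
      (fun x => (⟨x, chartField ℝ φ s x⟩ : TotalSpace E (TangentSpace 𝓘(ℝ, E) : M → Type _))) x) :
    ContDiffAt ℝ m s (φ x) := by
  have : IsManifold 𝓘(ℝ, E) 1 M := IsManifold.of_le (n := ω) (by simp)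
  have hφd := mdifferentiable_of_mem_atlas (I := 𝓘(ℝ, E)) hφ
  have h : ContMDiffAt 𝓘(ℝ, E) 𝓘(ℝ, E) ω φ.symm (φ x) :=
    contMDiffAt_symm_of_mem_maximalAtlas (IsManifold.subset_maximalAtlas hφ) (φ.map_source hx)
  have hinv : (mfderiv 𝓘(ℝ, E) 𝓘(ℝ, E) φ.symm (φ x)).IsInvertible :=
    ⟨hφd.symm.mfderiv (φ.map_source hx), rfl⟩
  have hs' := ContMDiffAt.mpullback_vectorField_preimage (n := ω) (by rwa [φ.left_inv hx]) h
    hinv (by simp)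
  refine (contMDiffAt_vectorSpace_iff_contDiffAt.1 hs').congr_of_eventuallyEq ?_
  filter_upwards [φ.open_target.mem_nhds (φ.map_source hx)] with b hb
  have hb' : (mfderiv 𝓘(ℝ, E) 𝓘(ℝ, E) φ.symm b).IsInvertible := ⟨hφd.symm.mfderiv hb, rfl⟩
  have hφb := isInvertible_mfderiv_chart (𝕜 := ℝ) hφ (φ.map_target hb)
  have h1 (v : E) : (mfderiv 𝓘(ℝ, E) 𝓘(ℝ, E) φ.symm b).inverse
      ((mfderiv 𝓘(ℝ, E) 𝓘(ℝ, E) φ (φ.symm b)).inverse v) = v := by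
    refine hb'.injective (hφb.injective ?_)
    rw [hb'.self_apply_inverse]
    exact (hφb.self_apply_inverse (v : TangentSpace 𝓘(ℝ, E) (φ (φ.symm b)))).trans
      (congrArg (fun A : E →L[ℝ] E => A v) (hφd.comp_symm_deriv hb)).symm
  have h2 := h1 (s b)
  have h3 : s (φ (φ.symm b)) = s b := by rw [φ.right_inv hb]
  rw [← h2, ← h3]
  rfl

/-- The bracket commutes with pullback, and constant fields on a vector space commute. -/
theorem mlieBracket_chartField_const (hφ : φ ∈ atlas E M) {x : M} (hx : x ∈ φ.source) (u v : E) :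
    VectorField.mlieBracket 𝓘(ℝ, E) (chartField ℝ φ fun _ => u) (chartField ℝ φ fun _ => v) x
      = 0 := by
  have h : ContMDiffAt 𝓘(ℝ, E) 𝓘(ℝ, E) ω φ x :=
    contMDiffAt_of_mem_maximalAtlas (IsManifold.subset_maximalAtlas hφ) hx
  refine (VectorField.mpullback_mlieBracket (n := ω)
    (mdifferentiableAt_vectorField_iff.2 (differentiableAt_const u))
    (mdifferentiableAt_vectorField_iff.2 (differentiableAt_const v)) h (by simp)).symm.trans ?_
  refine (congrArg (mfderiv 𝓘(ℝ, E) 𝓘(ℝ, E) φ x).inverse (?_ : _ = (0 : E))).trans (map_zero _)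
  have h0 := congrFun (VectorField.mlieBracketWithin_eq_lieBracketWithin (𝕜 := ℝ) (E := E)
    (V := fun _ => u) (W := fun _ => v) (s := univ)) (φ x)
  refine (congrFun (VectorField.mlieBracketWithin_univ (I := 𝓘(ℝ, E))
    (V := fun _ : E => u) (W := fun _ => v)).symm _).trans (h0.trans ?_)
  simp [VectorField.lieBracketWithin]
  rfl

variable [FiniteDimensional ℝ E]

/-- The formula `∇_t s = ∂_t s + Γ(t, s)`, from which symmetry, curvature and the transformation law
are read off. -/
theorem nabla_chartField (hφ : φ ∈ atlas E M) {x : M} (hx : x ∈ φ.source) {s : E → E}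
    (hs : DifferentiableAt ℝ s (φ x)) (t : E → E) :
    nabla (chartField ℝ φ s) x (chartField ℝ φ t x) =
      chartField ℝ φ (fun a => fderiv ℝ s a (t a) + christoffel nabla hφ a (t a) (s a)) x := by
  have h := chartConnection_eq nabla hφ (φ.map_source hx) hs (t (φ x))
  rw [chartConnection_apply _ hx] at h
  refine (isInvertible_mfderiv_chart (𝕜 := ℝ) hφ hx).injective ?_
  exact h.trans (mfderiv_chartField hφ hx
    (fun a => fderiv ℝ s a (t a) + christoffel nabla hφ a (t a) (s a))).symm

theorem christoffel_symm (htorsion : nabla.torsion = 0) (hφ : φ ∈ atlas E M) {a : E}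
    (ha : a ∈ φ.target) (u v : E) :
    christoffel nabla hφ a u v = christoffel nabla hφ a v u := by
  obtain ⟨x, hx, rfl⟩ : ∃ x ∈ φ.source, φ x = a := ⟨_, φ.map_target ha, φ.right_inv ha⟩
  have h := nabla.torsion_eq_zero_iff.1 htorsion
    (mdifferentiableAt_chartField hφ hx (differentiableAt_const u))
    (mdifferentiableAt_chartField hφ hx (differentiableAt_const v))
  rw [mlieBracket_chartField_const hφ hx, nabla_chartField nabla hφ hx (differentiableAt_const _),
    nabla_chartField nabla hφ hx (differentiableAt_const _), sub_eq_zero] at h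
  have h' := eq_of_chartField_eq hφ hx h
  simpa using h'

variable [T2Space M]

/-- Smoothness of the connection is a statement about global sections, while coordinate fields are
smooth only on the chart domain. A bump function equal to `1` near `x` bridges the gap, since a
covariant derivative is local. -/
theorem contMDiffAt_nabla_chartField (hsmooth : nabla.ContMDiffCovariantDerivative ∞)
    (hφ : φ ∈ atlas E M) {x : M} (hx : x ∈ φ.source) (u v : E) :
    ContMDiffAt 𝓘(ℝ, E) (𝓘(ℝ, E).prod 𝓘(ℝ, E)) ∞
      (fun x => (⟨x, nabla (chartField ℝ φ fun _ => v) x (chartField ℝ φ (fun _ => u) x)⟩ :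
        TotalSpace E (TangentSpace 𝓘(ℝ, E) : M → Type _))) x := by
  have : IsManifold 𝓘(ℝ, E) ∞ M := IsManifold.of_le (n := ω) (by simp)
  obtain ⟨f, -, hf⟩ := (SmoothBumpFunction.nhds_basis_tsupport (I := 𝓘(ℝ, E)) x).mem_iff.1
    (φ.open_source.mem_nhds hx)
  have hσ := ContMDiffOn.smul_section_of_tsupport (F := E) (n := ∞) f.contMDiff.contMDiffOn
    φ.open_source hf (s := chartField ℝ φ fun _ => v)
    (fun y hy => (contMDiffAt_chartField hφ hy contDiffAt_const).contMDiffWithinAt)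
  have h1 := hsmooth.contMDiff.contMDiff (σ := (f : M → ℝ) • chartField ℝ φ fun _ => v)
    (by simpa using! hσ.contMDiffOn)
  have h2 := (h1.contMDiffAt Filter.univ_mem : ContMDiffAt _ _ _ _ x).clm_bundle_apply
    (contMDiffAt_chartField hφ hx (contDiffAt_const (c := u)))
  refine h2.congr_of_eventuallyEq ?_
  filter_upwards [f.eventuallyEq_one.eventually_nhds, φ.open_source.mem_nhds hx] with y hy hyφ
  have hd := mdifferentiableAt_chartField (𝕜 := ℝ) hφ hyφ (differentiableAt_const v)
  have h3 : nabla (chartField ℝ φ fun _ => v) y =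
      nabla ((f : M → ℝ) • chartField ℝ φ fun _ => v) y := by
    refine nabla.isCovariantDerivativeOnUniv.congr_of_eventuallyEq hd
      ((hσ y).mdifferentiableAt (by simp)) Filter.univ_mem ?_
    filter_upwards [hy] with z hz
    simp [hz]
  rw [h3]

theorem contDiffOn_christoffel (hsmooth : nabla.ContMDiffCovariantDerivative ∞)
    (hφ : φ ∈ atlas E M) : ContDiffOn ℝ ∞ (christoffel nabla hφ) φ.target := by
  refine contDiffOn_clm_apply.2 fun u => contDiffOn_clm_apply.2 fun v a ha => ?_
  obtain ⟨x, hx, rfl⟩ : ∃ x ∈ φ.source, φ x = a := ⟨_, φ.map_target ha, φ.right_inv ha⟩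
  refine ContDiffAt.contDiffWithinAt (contDiffAt_of_contMDiffAt_chartField hφ hx ?_)
  refine (contMDiffAt_nabla_chartField nabla hsmooth hφ hx u v).congr_of_eventuallyEq ?_
  filter_upwards [φ.open_source.mem_nhds hx] with y hy
  rw [nabla_chartField nabla hφ hy (differentiableAt_const v)]
  simp

theorem differentiableAt_christoffel (hsmooth : nabla.ContMDiffCovariantDerivative ∞)
    (hφ : φ ∈ atlas E M) {a : E} (ha : a ∈ φ.target) :
    DifferentiableAt ℝ (christoffel nabla hφ) a :=
  ((contDiffOn_christoffel nabla hsmooth hφ).contDiffAt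
    (φ.open_target.mem_nhds ha)).differentiableAt (by simp)

/-- One half of the curvature on coordinate fields: `∇_v w` has expression `Γ(v, w)`, and
differentiating it along `u` gives `∂_u Γ(v, w) + Γ(u, Γ(v, w))`. -/
theorem curvature_chartField (hsmooth : nabla.ContMDiffCovariantDerivative ∞)
    (hφ : φ ∈ atlas E M) {x : M} (hx : x ∈ φ.source) (u v w : E) :
    nabla (fun y => nabla (chartField ℝ φ fun _ => w) y (chartField ℝ φ (fun _ => v) y)) x
      (chartField ℝ φ (fun _ => u) x) =
    chartField ℝ φ (fun a => fderiv ℝ (christoffel nabla hφ) a u v w +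
      christoffel nabla hφ a u (christoffel nabla hφ a v w)) x := by
  have hd := differentiableAt_christoffel nabla hsmooth hφ (φ.map_source hx)
  have hd' := differentiableAt_apply_apply hd v w
  have h1 : nabla (fun y => nabla (chartField ℝ φ fun _ => w) y (chartField ℝ φ (fun _ => v) y)) x =
      nabla (chartField ℝ φ fun a => christoffel nabla hφ a v w) x := by
    refine nabla.isCovariantDerivativeOnUniv.congr_of_eventuallyEq
      ((contMDiffAt_nabla_chartField nabla hsmooth hφ hx v w).mdifferentiableAt (by simp))
      (mdifferentiableAt_chartField hφ hx hd') Filter.univ_mem ?_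
    filter_upwards [φ.open_source.mem_nhds hx] with y hy
    rw [nabla_chartField nabla hφ hy (differentiableAt_const w)]
    simp
  rw [h1, nabla_chartField nabla hφ hx hd']
  refine congrArg (mfderiv 𝓘(ℝ, E) 𝓘(ℝ, E) φ x).inverse ?_
  change fderiv ℝ (fun a => christoffel nabla hφ a v w) (φ x) u + _ = _
  rw [fderiv_apply_apply hd]

end Christoffel

/-! ### Transformation law of Christoffel symbols -/

section Transition

variable {E : Type*} [NormedAddCommGroup E] [NormedSpace ℝ E]
  {M : Type*} [TopologicalSpace M] [ChartedSpace E M] [IsManifold 𝓘(ℝ, E) ω M]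
  {φ ψ : OpenPartialHomeomorph M E}

theorem contDiffAt_transition (hφ : φ ∈ atlas E M) (hψ : ψ ∈ atlas E M) {x : M}
    (hx : x ∈ φ.source) (hx' : x ∈ ψ.source) : ContDiffAt ℝ ω (ψ ∘ φ.symm) (φ x) := by
  have h1 : ContMDiffAt 𝓘(ℝ, E) 𝓘(ℝ, E) ω φ.symm (φ x) :=
    contMDiffAt_symm_of_mem_maximalAtlas (IsManifold.subset_maximalAtlas hφ) (φ.map_source hx)
  have h2 : ContMDiffAt 𝓘(ℝ, E) 𝓘(ℝ, E) ω ψ (φ.symm (φ x)) :=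
    contMDiffAt_of_mem_maximalAtlas (IsManifold.subset_maximalAtlas hψ) (by rwa [φ.left_inv hx])
  exact (h2.comp _ h1).contDiffAt

theorem chartField_eq_chartField (hφ : φ ∈ atlas E M) (hψ : ψ ∈ atlas E M) {x : M}
    (hx : x ∈ φ.source) (hx' : x ∈ ψ.source) (v : E) :
    chartField ℝ φ (fun _ => v) x =
      chartField ℝ ψ (fun c => fderiv ℝ (ψ ∘ φ.symm) (φ (ψ.symm c)) v) x := by
  have : IsManifold 𝓘(ℝ, E) 1 M := IsManifold.of_le (n := ω) (by simp)
  have hφd := mdifferentiable_of_mem_atlas (I := 𝓘(ℝ, E)) hφ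
  have hψd := mdifferentiable_of_mem_atlas (I := 𝓘(ℝ, E)) hψ
  refine (isInvertible_mfderiv_chart (𝕜 := ℝ) hψ hx').injective ?_
  refine Eq.trans ?_ (mfderiv_chartField hψ hx' _).symm
  have h1 := mfderiv_chartField (𝕜 := ℝ) hφ hx (fun _ => v)
  have h2 : HasMFDerivAt 𝓘(ℝ, E) 𝓘(ℝ, E) ((ψ ∘ φ.symm) ∘ φ) x
      ((fderiv ℝ (ψ ∘ φ.symm) (φ x)) ∘L (mfderiv 𝓘(ℝ, E) 𝓘(ℝ, E) φ x)) :=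
    HasMFDerivAt.comp x (((contDiffAt_transition hφ hψ hx hx').differentiableAt
      (by simp)).hasFDerivAt.hasMFDerivAt) (hφd.mdifferentiableAt hx).hasMFDerivAt
  have h3 : HasMFDerivAt 𝓘(ℝ, E) 𝓘(ℝ, E) ψ x
      ((fderiv ℝ (ψ ∘ φ.symm) (φ x)) ∘L (mfderiv 𝓘(ℝ, E) 𝓘(ℝ, E) φ x)) := by
    refine h2.congr_of_eventuallyEq ?_
    filter_upwards [φ.open_source.mem_nhds hx] with y hy
    exact congrArg ψ (φ.left_inv hy).symm
  rw [h3.mfderiv, ψ.left_inv hx']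
  exact congrArg (fderiv ℝ (ψ ∘ φ.symm) (φ x)) h1

variable [CompleteSpace E] [FiniteDimensional ℝ E]
  (nabla : CovariantDerivative 𝓘(ℝ, E) E (fun x : M => TangentSpace 𝓘(ℝ, E) x))

/-- Computes `∇_u v`, for fields constant in `φ`, in both charts. In `ψ` such a field is the
derivative of the transition map applied to a constant, and differentiating it produces the
second-derivative term. Only the germ of the transition map matters, so any `T` agreeing with it
locally may be used. -/
theorem christoffel_transition (hφ : φ ∈ atlas E M) (hψ : ψ ∈ atlas E M) {x : M}
    (hx : x ∈ φ.source) (hx' : x ∈ ψ.source) {T : E → E} (hT : ψ ∘ φ.symm =ᶠ[𝓝 (φ x)] T)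
    (u v : E) :
    christoffel nabla hψ (ψ x) (fderiv ℝ T (φ x) u) (fderiv ℝ T (φ x) v) +
      fderiv ℝ (fderiv ℝ T) (φ x) u v = fderiv ℝ T (φ x) (christoffel nabla hφ (φ x) u v) := by
  rw [← hT.fderiv.fderiv_eq, ← hT.fderiv_eq]
  set S := ψ ∘ φ.symm with hS
  have hSd : ContDiffAt ℝ ω S (φ x) := contDiffAt_transition hφ hψ hx hx'
  set s : E → E := fun c => fderiv ℝ S (φ (ψ.symm c)) v with hs
  have hS' : ContDiffAt ℝ ω (fderiv ℝ S) (φ x) := hSd.fderiv_right (by simp)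
  have hS'd : DifferentiableAt ℝ (fderiv ℝ S) (φ x) := hS'.differentiableAt (by simp)
  have hSd1 : DifferentiableAt ℝ S (φ x) := hSd.differentiableAt (by simp)
  have hSx : S (φ x) = ψ x := congrArg ψ (φ.left_inv hx)
  have hsd : DifferentiableAt ℝ s (ψ x) := by
    have h1 := (contDiffAt_transition hψ hφ hx' hx).differentiableAt (by simp)
    have h2 : DifferentiableAt ℝ (fderiv ℝ S) ((φ ∘ ψ.symm) (ψ x)) := by
      have : (φ ∘ ψ.symm) (ψ x) = φ x := congrArg φ (ψ.left_inv hx')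
      rwa [this]
    exact (h2.comp _ h1).clm_apply (differentiableAt_const v)
  have hnear : ∀ᶠ y in 𝓝 x, chartField ℝ φ (fun _ => v) y = chartField ℝ ψ s y := by
    filter_upwards [φ.open_source.mem_nhds hx, ψ.open_source.mem_nhds hx'] with y hy hy'
    exact chartField_eq_chartField hφ hψ hy hy' v
  have h1 := nabla.isCovariantDerivativeOnUniv.congr_of_eventuallyEq
    (mdifferentiableAt_chartField hφ hx (differentiableAt_const v))
    (mdifferentiableAt_chartField hψ hx' hsd) Filter.univ_mem hnear
  have h2 := nabla_chartField nabla hφ hx (differentiableAt_const v) (fun _ => u)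
  have h3 := nabla_chartField nabla hψ hx' hsd (fun c => fderiv ℝ S (φ (ψ.symm c)) u)
  rw [← chartField_eq_chartField hφ hψ hx hx' u, ← h1, h2] at h3
  have h4 : chartField ℝ φ (fun a => fderiv ℝ (fun _ => v) a u + christoffel nabla hφ a u v) x =
      chartField ℝ φ (fun _ => christoffel nabla hφ (φ x) u v) x := by
    refine congrArg (mfderiv 𝓘(ℝ, E) 𝓘(ℝ, E) φ x).inverse ?_
    change fderiv ℝ (fun _ => v) (φ x) u + christoffel nabla hφ (φ x) u v = _
    simp
  rw [h4, chartField_eq_chartField hφ hψ hx hx'] at h3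
  have h5 := eq_of_chartField_eq hψ hx' h3
  simp only [ψ.left_inv hx', hs] at h5
  have h6 : fderiv ℝ s (ψ x) (fderiv ℝ S (φ x) u) = fderiv ℝ (fderiv ℝ S) (φ x) u v := by
    have h7 : HasFDerivAt (s ∘ S) (fderiv ℝ s (ψ x) ∘L fderiv ℝ S (φ x)) (φ x) := by
      refine HasFDerivAt.comp _ ?_ hSd1.hasFDerivAt
      rw [hSx]
      exact hsd.hasFDerivAt
    -- Seen from `φ`, the expression `s` of the field is the derivative of `S` applied to `v`; the
    -- chain rule then yields the second derivative of `S`.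
    have h8 : s ∘ S =ᶠ[𝓝 (φ x)] fun b => fderiv ℝ S b v := by
      have hc : ContinuousAt φ.symm (φ x) := φ.continuousAt_symm (φ.map_source hx)
      filter_upwards [φ.open_target.mem_nhds (φ.map_source hx),
        hc.preimage_mem_nhds (by
          rw [φ.left_inv hx]
          exact ψ.open_source.mem_nhds hx')] with b hb hb'
      change fderiv ℝ S (φ (ψ.symm (ψ (φ.symm b)))) v = _
      rw [ψ.left_inv hb', φ.right_inv hb]
    have h9 := (hS'd.hasFDerivAt.clm_apply (hasFDerivAt_const v (φ x))).congr_of_eventuallyEq h8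
    have := congrArg (fun A : E →L[ℝ] E => A u) (h7.unique h9)
    simpa using this
  rw [← h6, h5]
  exact add_comm _ _

end Transition

/-! ### Complex linearity and the complex structure in charts -/

section ComplexBilinear

variable {E F G : Type*} [NormedAddCommGroup E] [NormedSpace ℂ E]
  [NormedAddCommGroup F] [NormedSpace ℂ F]
  [NormedAddCommGroup G] [NormedSpace ℂ G]

theorem complex_smul_eq_re_smul_add_im_smul_I_smul (c : ℂ) (v : E) :
    c • v = c.re • v + c.im • Complex.I • v := by
  conv_lhs => rw [← Complex.re_add_im c]
  rw [add_smul, mul_smul, Complex.coe_smul, Complex.coe_smul]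

theorem map_complex_smul_of_map_I_smul (f : E →L[ℝ] G)
    (h : ∀ v, f (Complex.I • v) = Complex.I • f v) (c : ℂ) (v : E) : f (c • v) = c • f v := by
  rw [complex_smul_eq_re_smul_add_im_smul_I_smul c v, map_add, map_smul, map_smul, h,
    ← complex_smul_eq_re_smul_add_im_smul_I_smul]

theorem exists_complex_bilinear [FiniteDimensional ℂ E] [FiniteDimensional ℂ F]
    (B : E →L[ℝ] F →L[ℝ] G)
    (h1 : ∀ u v, B (Complex.I • u) v = Complex.I • B u v)
    (h2 : ∀ u v, B u (Complex.I • v) = Complex.I • B u v) :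
    ∃ C : E →L[ℂ] F →L[ℂ] G, ∀ u v, C u v = B u v := by
  let L : E →ₗ[ℂ] F →ₗ[ℂ] G := LinearMap.mk₂ ℂ (fun u v => B u v)
    (fun u u' v => by simp)
    (fun c u v => map_complex_smul_of_map_I_smul (B.flip v) (fun u => h1 u v) c u)
    (fun u v v' => by simp)
    (fun c u v => map_complex_smul_of_map_I_smul (B u) (h2 u) c v)
  exact ⟨LinearMap.toContinuousLinearMap
    ((LinearMap.toContinuousLinearMap : (F →ₗ[ℂ] G) ≃ₗ[ℂ] F →L[ℂ] G).toLinearMap ∘ₗ L),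
    fun u v => rfl⟩

/-- A real differentiable map with complex linear derivative is complex differentiable. -/
theorem differentiableAt_complex_of_fderiv_I_smul [FiniteDimensional ℂ E] {f : E → G} {a : E}
    (hf : DifferentiableAt ℝ f a)
    (h : ∀ v, fderiv ℝ f a (Complex.I • v) = Complex.I • fderiv ℝ f a v) :
    DifferentiableAt ℂ f a := by
  let L : E →ₗ[ℂ] G :=
    { toFun := fderiv ℝ f a
      map_add' := map_add _
      map_smul' := map_complex_smul_of_map_I_smul _ h }
  have h1 : HasFDerivAt f ((LinearMap.toContinuousLinearMap L).restrictScalars ℝ) a := by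
    convert! hf.hasFDerivAt
  exact (hasFDerivAt_of_restrictScalars ℝ h1 rfl).differentiableAt

end ComplexBilinear

section ComplexStructure

variable {n : ℕ} {M : Type*} [TopologicalSpace M] [ChartedSpace (Fin n → ℂ) M]
  {φ : OpenPartialHomeomorph M (Fin n → ℂ)}

theorem mfderiv_real_apply {x : M} {f : M → Fin n → ℂ}
    (h : MDifferentiableAt 𝓘(ℂ, Fin n → ℂ) 𝓘(ℂ, Fin n → ℂ) f x)
    (v : Fin n → ℂ) :
    (mfderiv 𝓘(ℝ, Fin n → ℂ) 𝓘(ℝ, Fin n → ℂ) f x v : Fin n → ℂ) =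
      mfderiv 𝓘(ℂ, Fin n → ℂ) 𝓘(ℂ, Fin n → ℂ) f x v := by
  have h' : DifferentiableAt ℂ (writtenInExtChartAt 𝓘(ℂ, Fin n → ℂ) 𝓘(ℂ, Fin n → ℂ) x f)
      (extChartAt 𝓘(ℂ, Fin n → ℂ) x x) := by
    rw [← differentiableWithinAt_univ, ← ModelWithCorners.range_eq_univ 𝓘(ℂ, Fin n → ℂ)]
    exact h.differentiableWithinAt_writtenInExtChartAt
  have h2 : MDifferentiableAt 𝓘(ℝ, Fin n → ℂ) 𝓘(ℝ, Fin n → ℂ) f x := by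
    refine mdifferentiableAt_iff _ _ |>.2 ⟨h.continuousAt, ?_⟩
    exact (h'.restrictScalars ℝ).differentiableWithinAt
  have e1 := h.mfderiv
  have e2 := h2.mfderiv
  rw [ModelWithCorners.range_eq_univ, fderivWithin_univ] at e1 e2
  refine (congrArg (fun A : (Fin n → ℂ) →L[ℝ] (Fin n → ℂ) => A v)
    (e2.trans (h'.fderiv_restrictScalars ℝ))).trans ?_
  exact (congrArg (fun A : (Fin n → ℂ) →L[ℂ] (Fin n → ℂ) => A v) e1).symm

/-- `tangentJ` is defined through the preferred chart at each point. Since `φ` is holomorphic, its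
real derivative is complex linear and carries `tangentJ` to multiplication by `Complex.I`. -/
theorem mfderiv_tangentJ [IsManifold 𝓘(ℂ, Fin n → ℂ) ω M]
    (hφ : φ ∈ atlas (Fin n → ℂ) M) {x : M} (hx : x ∈ φ.source)
    {v : TangentSpace 𝓘(ℝ, Fin n → ℂ) x} {w : Fin n → ℂ}
    (hw : mfderiv 𝓘(ℝ, Fin n → ℂ) 𝓘(ℝ, Fin n → ℂ) φ x v = w) :
    mfderiv 𝓘(ℝ, Fin n → ℂ) 𝓘(ℝ, Fin n → ℂ) φ x (tangentJ x v) = Complex.I • w := by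
  have : IsManifold 𝓘(ℂ, Fin n → ℂ) 1 M := IsManifold.of_le (n := ω) (by simp)
  have hφd := (mdifferentiable_of_mem_atlas (I := 𝓘(ℂ, Fin n → ℂ)) hφ).mdifferentiableAt hx
  rw [← hw]
  have h1 := mfderiv_real_apply hφd v
  have h2 := mfderiv_real_apply hφd (tangentJ x v)
  refine h2.trans (Eq.trans ?_ (congrArg (fun w : Fin n → ℂ => Complex.I • w) h1.symm))
  exact map_smul (mfderiv 𝓘(ℂ, Fin n → ℂ) 𝓘(ℂ, Fin n → ℂ) φ x) Complex.I
    (show TangentSpace 𝓘(ℂ, Fin n → ℂ) x from v)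

variable [IsManifold 𝓘(ℝ, Fin n → ℂ) ω M]
  (nabla : CovariantDerivative 𝓘(ℝ, Fin n → ℂ) (Fin n → ℂ)
    (fun x : M => TangentSpace 𝓘(ℝ, Fin n → ℂ) x))

/-- Flatness evaluated on constant chart fields, whose brackets vanish. -/
theorem christoffel_flat [T2Space M] (hsmooth : nabla.ContMDiffCovariantDerivative ∞) (hflat : nabla.IsFlat)
    (hφ : φ ∈ atlas (Fin n → ℂ) M) {a : Fin n → ℂ} (ha : a ∈ φ.target) (u v w : Fin n → ℂ) :
    fderiv ℝ (christoffel nabla hφ) a u v w - fderiv ℝ (christoffel nabla hφ) a v u w +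
      christoffel nabla hφ a u (christoffel nabla hφ a v w) -
      christoffel nabla hφ a v (christoffel nabla hφ a u w) = 0 := by
  obtain ⟨x, hx, rfl⟩ : ∃ x ∈ φ.source, φ x = a := ⟨_, φ.map_target ha, φ.right_inv ha⟩
  have hc (u : Fin n → ℂ) : IsSmoothVectorFieldOn (chartField ℝ φ fun _ => u) φ.source :=
    fun y hy => (contMDiffAt_chartField hφ hy contDiffAt_const).contMDiffWithinAt
  have h := hflat φ.source φ.open_source _ _ _ (hc u) (hc v) (hc w) x hx
  rw [curvature_chartField nabla hsmooth hφ hx, curvature_chartField nabla hsmooth hφ hx,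
    mlieBracket_chartField_const hφ hx, map_zero, sub_zero, sub_eq_zero] at h
  have h2 := eq_of_chartField_eq hφ hx h
  rw [← sub_eq_zero.2 h2]
  abel

variable [IsManifold 𝓘(ℂ, Fin n → ℂ) ω M]

theorem tangentJ_chartField (hφ : φ ∈ atlas (Fin n → ℂ) M) {x : M} (hx : x ∈ φ.source)
    (s : (Fin n → ℂ) → Fin n → ℂ) :
    tangentJ x (chartField ℝ φ s x) = chartField ℝ φ (Complex.I • s) x := by
  refine (isInvertible_mfderiv_chart (𝕜 := ℝ) hφ hx).injective ?_
  exact (mfderiv_tangentJ hφ hx (mfderiv_chartField hφ hx s)).trans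
    (mfderiv_chartField hφ hx (Complex.I • s)).symm

/-- For a constant field `v` in the chart, `tangentJ` applied to it is the constant field `Complex.I
• v`; complex linearity of `∇` compares their covariant derivatives. -/
theorem christoffel_I_smul_right (hcompat : nabla.IsCompatibleWithHolomorphicStructure)
    (hφ : φ ∈ atlas (Fin n → ℂ) M) {a : Fin n → ℂ} (ha : a ∈ φ.target) (u v : Fin n → ℂ) :
    christoffel nabla hφ a u (Complex.I • v) = Complex.I • christoffel nabla hφ a u v := by
  obtain ⟨x, hx, rfl⟩ : ∃ x ∈ φ.source, φ x = a := ⟨_, φ.map_target ha, φ.right_inv ha⟩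
  have h := hcompat.complex_linear φ.source φ.open_source (chartField ℝ φ fun _ => v)
    (fun y hy => (contMDiffAt_chartField hφ hy contDiffAt_const).contMDiffWithinAt) x hx
    (chartField ℝ φ (fun _ => u) x)
  have hJ : ∀ᶠ y in 𝓝 x, chartField ℝ φ (fun _ => Complex.I • v) y =
      tangentJ y (chartField ℝ φ (fun _ => v) y) := by
    filter_upwards [φ.open_source.mem_nhds hx] with y hy
    exact (tangentJ_chartField hφ hy _).symm
  have hd := mdifferentiableAt_chartField (𝕜 := ℝ) hφ hx (differentiableAt_const (Complex.I • v))
  have h1 : nabla (chartField ℝ φ fun _ => Complex.I • v) x =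
      nabla (fun y => tangentJ y (chartField ℝ φ (fun _ => v) y)) x := by
    refine nabla.isCovariantDerivativeOnUniv.congr_of_eventuallyEq hd
      (hd.congr_of_eventuallyEq ?_) Filter.univ_mem hJ
    filter_upwards [hJ] with y hy
    rw [hy]
  rw [← h1, nabla_chartField nabla hφ hx (differentiableAt_const _),
    nabla_chartField nabla hφ hx (differentiableAt_const _), tangentJ_chartField hφ hx] at h
  have h2 := eq_of_chartField_eq hφ hx h
  simpa using h2

/-- Torsion-freeness swaps the arguments, so linearity in the section passes to the direction. -/
theorem christoffel_I_smul_left (htorsion : nabla.torsion = 0)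
    (hcompat : nabla.IsCompatibleWithHolomorphicStructure)
    (hφ : φ ∈ atlas (Fin n → ℂ) M) {a : Fin n → ℂ} (ha : a ∈ φ.target) (u v : Fin n → ℂ) :
    christoffel nabla hφ a (Complex.I • u) v = Complex.I • christoffel nabla hφ a u v := by
  rw [christoffel_symm nabla htorsion hφ ha, christoffel_I_smul_right nabla hcompat hφ ha,
    christoffel_symm nabla htorsion hφ ha]

end ComplexStructure

section SecondDerivative

variable {E F : Type*} [NormedAddCommGroup E] [NormedSpace ℂ E] [NormedAddCommGroup F]
  [NormedSpace ℂ F] {f : E → F}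

theorem fderiv_real_apply {a : E} (hf : DifferentiableAt ℂ f a) (u : E) :
    fderiv ℝ f a u = fderiv ℂ f a u :=
  congrArg (fun A : E →L[ℝ] F => A u) (hf.fderiv_restrictScalars ℝ)

theorem fderiv_fderiv_real_apply (hf : ContDiff ℂ 2 f) (a u v : E) :
    fderiv ℝ (fderiv ℝ f) a u v = fderiv ℂ (fderiv ℂ f) a u v := by
  have h1 : DifferentiableAt ℂ (fderiv ℂ f) a :=
    (hf.fderiv_right (m := 1) (by norm_num)).differentiable (by simp) a
  have h2 : DifferentiableAt ℝ (fderiv ℝ f) a :=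
    ((hf.restrict_scalars ℝ).fderiv_right (m := 1) (by norm_num)).differentiable (by simp) a
  have h3 : (fun x => fderiv ℝ f x v) = fun x => fderiv ℂ f x v :=
    funext fun x => fderiv_real_apply (hf.differentiable (by simp) x) v
  have h4 := congrArg (fun A : E →L[ℝ] F => A u) (h2.hasFDerivAt.clm_apply
    (hasFDerivAt_const v a)).fderiv
  have h5 := h1.hasFDerivAt.clm_apply (hasFDerivAt_const v a)
  have h6 := fderiv_real_apply h5.differentiableAt u
  rw [h5.fderiv] at h6
  rw [h3] at h4
  simpa [h6] using h4.symm

end SecondDerivative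

/-! ### Holomorphic Christoffel symbols on the punctured space -/

namespace HopfManifold

variable {n : ℕ} {γ : HolomorphicContraction n}

theorem chart_transition {φ ψ : OpenPartialHomeomorph (HopfManifold γ) (Fin n → ℂ)}
    (hφ : φ ∈ charts γ) (hψ : ψ ∈ charts γ) {T : (Fin n → ℂ) → (Fin n → ℂ)}
    (hT : ∀ z (hz : z ≠ 0), ∃ h : T z ≠ 0, proj γ ⟨T z, h⟩ = proj γ ⟨z, hz⟩)
    {b : Fin n → ℂ} (hb : b ∈ φ.target) (hTb : T b ∈ ψ.target) :
    φ.symm b ∈ ψ.source ∧ ψ (φ.symm b) = T b := by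
  obtain ⟨hb0, h1⟩ := proj_apply_chart γ hφ hb
  obtain ⟨_, h2⟩ := proj_apply_chart γ hψ hTb
  obtain ⟨_, h3⟩ := hT b hb0
  have h4 : φ.symm b = ψ.symm (T b) := by rw [← h1, ← h2, h3]
  rw [h4]
  exact ⟨ψ.map_target hTb, ψ.right_inv hTb⟩

variable (nabla : CovariantDerivative 𝓘(ℝ, Fin n → ℂ) (Fin n → ℂ)
  (fun x : HopfManifold γ => TangentSpace 𝓘(ℝ, Fin n → ℂ) x))

/-- A map `T` covering the identity of the Hopf manifold represents a change of chart wherever its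
values lie in the second chart. With `T = id` this gives independence of the chart, with `T = γ` the
invariance of the symbols. -/
theorem christoffel_chart_transition {φ ψ : OpenPartialHomeomorph (HopfManifold γ) (Fin n → ℂ)}
    (hφ : φ ∈ charts γ) (hψ : ψ ∈ charts γ) {T : (Fin n → ℂ) → (Fin n → ℂ)} (hTc : ContDiff ℂ ω T)
    (hT : ∀ z (hz : z ≠ 0), ∃ h : T z ≠ 0, proj γ ⟨T z, h⟩ = proj γ ⟨z, hz⟩)
    {b : Fin n → ℂ} (hb : b ∈ φ.target) (hTb : T b ∈ ψ.target) (u v : Fin n → ℂ) :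
    christoffel nabla (φ := ψ) hψ (T b) (fderiv ℂ T b u) (fderiv ℂ T b v) +
      fderiv ℂ (fderiv ℂ T) b u v = fderiv ℂ T b (christoffel nabla (φ := φ) hφ b u v) := by
  obtain ⟨h1, h2⟩ := chart_transition hφ hψ hT hb hTb
  have hev : ψ ∘ φ.symm =ᶠ[𝓝 b] T := by
    filter_upwards [φ.open_target.mem_nhds hb,
      hTc.continuous.continuousAt.preimage_mem_nhds (ψ.open_target.mem_nhds hTb)] with c hc hTc
    exact (chart_transition hφ hψ hT hc hTc).2
  have h3 := φ.right_inv hb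
  have key := christoffel_transition nabla (φ := φ) (ψ := ψ) hφ hψ (φ.map_target hb) h1
    (T := T) (by rwa [h3]) u v
  rw [h3, h2] at key
  have hTd : DifferentiableAt ℂ T b := hTc.differentiable (by simp) b
  rwa [fderiv_real_apply hTd, fderiv_real_apply hTd, fderiv_real_apply hTd,
    fderiv_fderiv_real_apply (hTc.of_le (by simp))] at key

/-- Charts are local inverses of one covering map, so charts sharing a value `b` invert it
identically near `b`. The symbols thus depend only on the point of `ℂⁿ ∖ 0`. -/
theorem christoffel_eq {φ ψ : OpenPartialHomeomorph (HopfManifold γ) (Fin n → ℂ)}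
    (hφ : φ ∈ charts γ) (hψ : ψ ∈ charts γ) {b : Fin n → ℂ} (hb : b ∈ φ.target)
    (hb' : b ∈ ψ.target) :
    christoffel nabla (φ := ψ) hψ b = christoffel nabla (φ := φ) hφ b := by
  ext1 u
  ext1 v
  have h := christoffel_chart_transition nabla hφ hψ contDiff_id (fun z hz => ⟨hz, rfl⟩) hb hb' u v
  have h1 : fderiv ℂ (fderiv ℂ (id : (Fin n → ℂ) → (Fin n → ℂ))) b = 0 := by
    have : fderiv ℂ (id : (Fin n → ℂ) → (Fin n → ℂ)) =
      fun _ => ContinuousLinearMap.id ℂ (Fin n → ℂ) := funext fun x => fderiv_id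
    rw [this, fderiv_fun_const]
    rfl
  simpa [h1] using h

variable {nabla}

/-- Holomorphy of the symbols. Flatness reads `∂_u Γ(v, w) = ∂_v Γ(u, w) - Γ(u, Γ(v, w)) + Γ(v, Γ(u,
w))`, and complex bilinearity of `Γ` makes the right side complex linear in `u`. -/
theorem fderiv_christoffel_I_smul (hsmooth : nabla.ContMDiffCovariantDerivative ∞)
    (htorsion : nabla.torsion = 0) (hflat : nabla.IsFlat)
    (hcompat : nabla.IsCompatibleWithHolomorphicStructure)
    {φ : OpenPartialHomeomorph (HopfManifold γ) (Fin n → ℂ)} (hφ : φ ∈ atlas _ (HopfManifold γ))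
    {a : Fin n → ℂ} (ha : a ∈ φ.target) (u v w : Fin n → ℂ) :
    fderiv ℝ (christoffel nabla hφ) a (Complex.I • u) v w =
      Complex.I • fderiv ℝ (christoffel nabla hφ) a u v w := by
  have hd := differentiableAt_christoffel nabla hsmooth hφ ha
  have h1 : fderiv ℝ (christoffel nabla hφ) a v (Complex.I • u) w =
      Complex.I • fderiv ℝ (christoffel nabla hφ) a v u w := by
    rw [← fderiv_apply_apply hd, ← fderiv_apply_apply hd]
    have h2 : (fun x => christoffel nabla hφ x (Complex.I • u) w) =ᶠ[𝓝 a]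
        fun x => Complex.I • christoffel nabla hφ x u w := by
      filter_upwards [φ.open_target.mem_nhds ha] with b hb
      exact christoffel_I_smul_left nabla htorsion hcompat hφ hb u w
    rw [h2.fderiv_eq, fderiv_fun_const_smul (differentiableAt_apply_apply hd u w)]
    rfl
  have h3 := christoffel_flat nabla hsmooth hflat hφ ha (Complex.I • u) v w
  have h4 := christoffel_flat nabla hsmooth hflat hφ ha u v w
  have h5 (x y) := christoffel_I_smul_left nabla htorsion hcompat hφ ha x y
  have h6 (x y) := christoffel_I_smul_right nabla hcompat hφ ha x y
  have key (X A B C D : Fin n → ℂ)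
      (h : X - Complex.I • B + Complex.I • C - Complex.I • D = 0) (h' : A - B + C - D = 0) :
      X = Complex.I • A := by
    have h'' := congrArg (Complex.I • ·) h'
    simp only [smul_sub, smul_add, smul_zero] at h''
    rw [← h''] at h
    simpa using h
  rw [h5, h5, h6, h1] at h3
  exact key _ _ _ _ _ h3 h4

variable (nabla)

/-- The symbols of the pullback of `∇` to `ℂⁿ ∖ 0`, glued from the charts of the quotient.
Holomorphy is checked on each entry `Γ x v w` and then lifted to `Γ` in finite dimension. -/
theorem exists_christoffel_symbols (hsmooth : nabla.ContMDiffCovariantDerivative ∞)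
    (htorsion : nabla.torsion = 0) (hflat : nabla.IsFlat)
    (hcompat : nabla.IsCompatibleWithHolomorphicStructure) :
    ∃ Γ : (Fin n → ℂ) → (Fin n → ℂ) →L[ℂ] (Fin n → ℂ) →L[ℂ] (Fin n → ℂ),
      DifferentiableOn ℂ Γ {0}ᶜ ∧
      (∀ x ≠ 0, ∀ u v, Γ x u v = Γ x v u) ∧
      (∀ x ≠ 0, ∀ u v w, fderiv ℂ Γ x u v w - fderiv ℂ Γ x v u w +
        Γ x u (Γ x v w) - Γ x v (Γ x u w) = 0) ∧
      (∀ x ≠ 0, ∀ u v, Γ (γ.toFun x) (fderiv ℂ γ.toFun x u) (fderiv ℂ γ.toFun x v) +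
        fderiv ℂ (fderiv ℂ γ.toFun) x u v = fderiv ℂ γ.toFun x (Γ x u v)) := by
  have hex (z : Fin n → ℂ) : ∃ C : (Fin n → ℂ) →L[ℂ] (Fin n → ℂ) →L[ℂ] (Fin n → ℂ),
      ∀ (φ : OpenPartialHomeomorph (HopfManifold γ) (Fin n → ℂ)) (hφ : φ ∈ charts γ),
        z ∈ φ.target → ∀ u v, C u v = christoffel nabla (φ := φ) hφ z u v := by
    by_cases hz : z = 0
    -- The origin is never the value of a chart, so any choice works there.
    · refine ⟨0, fun φ hφ hzφ => ?_⟩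
      exact absurd hz (proj_apply_chart γ hφ hzφ).1
    · obtain ⟨φ, hφ, hzφ, -⟩ := exists_chart_target γ hz
      obtain ⟨C, hC⟩ := exists_complex_bilinear (christoffel nabla (φ := φ) hφ z)
        (christoffel_I_smul_left nabla htorsion hcompat (φ := φ) hφ hzφ)
        (christoffel_I_smul_right nabla hcompat (φ := φ) hφ hzφ)
      refine ⟨C, fun ψ hψ hzψ u v => ?_⟩
      rw [hC, christoffel_eq nabla hφ hψ hzφ hzψ]
  choose Γ hΓ using hex
  have hloc {φ : OpenPartialHomeomorph (HopfManifold γ) (Fin n → ℂ)} (hφ : φ ∈ charts γ)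
      {a : Fin n → ℂ} (ha : a ∈ φ.target) (v w : Fin n → ℂ) :
      (fun x => Γ x v w) =ᶠ[𝓝 a] fun x => christoffel nabla (φ := φ) hφ x v w := by
    filter_upwards [φ.open_target.mem_nhds ha] with b hb
    exact hΓ b φ hφ hb v w
  have hdvw {a : Fin n → ℂ} (ha : a ≠ 0) (v w : Fin n → ℂ) :
      DifferentiableAt ℂ (fun x => Γ x v w) a := by
    obtain ⟨φ, hφ, haφ, -⟩ := exists_chart_target γ ha
    have hd := differentiableAt_christoffel nabla hsmooth (φ := φ) hφ haφ
    refine DifferentiableAt.congr_of_eventuallyEq ?_ (hloc hφ haφ v w)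
    refine differentiableAt_complex_of_fderiv_I_smul (differentiableAt_apply_apply hd v w) ?_
    intro u
    rw [fderiv_apply_apply hd, fderiv_apply_apply hd]
    exact fderiv_christoffel_I_smul hsmooth htorsion hflat hcompat hφ haφ u v w
  have hopen : IsOpen ({0}ᶜ : Set (Fin n → ℂ)) := isOpen_compl_singleton
  have hcd : ContDiffOn ℂ ω Γ {0}ᶜ :=
    contDiffOn_clm_apply.2 fun v => contDiffOn_clm_apply.2 fun w =>
      DifferentiableOn.contDiffOn_pi hopen fun a ha => (hdvw ha v w).differentiableWithinAt
  have hd : DifferentiableOn ℂ Γ {0}ᶜ := hcd.differentiableOn (by simp)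
  have hda {a : Fin n → ℂ} (ha : a ≠ 0) : DifferentiableAt ℂ Γ a :=
    hd.differentiableAt (hopen.mem_nhds ha)
  refine ⟨Γ, hd, fun x hx u v => ?_, fun x hx u v w => ?_, fun x hx u v => ?_⟩
  · obtain ⟨φ, hφ, hxφ, -⟩ := exists_chart_target γ hx
    rw [hΓ x φ hφ hxφ, hΓ x φ hφ hxφ, christoffel_symm nabla htorsion (φ := φ) hφ hxφ]
  · obtain ⟨φ, hφ, hxφ, -⟩ := exists_chart_target γ hx
    have hfd (u v w : Fin n → ℂ) : fderiv ℂ Γ x u v w =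
        fderiv ℝ (christoffel nabla (φ := φ) hφ) x u v w := by
      rw [← fderiv_apply_apply (hda hx), ← fderiv_real_apply (hdvw hx v w),
        (hloc hφ hxφ v w).fderiv_eq,
        fderiv_apply_apply (differentiableAt_christoffel nabla hsmooth (φ := φ) hφ hxφ)]
    rw [hfd, hfd, hΓ x φ hφ hxφ, hΓ x φ hφ hxφ, hΓ x φ hφ hxφ, hΓ x φ hφ hxφ]
    exact christoffel_flat nabla hsmooth hflat (φ := φ) hφ hxφ u v w
  · have hproj (z : Fin n → ℂ) (hz : z ≠ 0) :
        ∃ h : γ.toFun z ≠ 0, proj γ ⟨γ.toFun z, h⟩ = proj γ ⟨z, hz⟩ :=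
      ⟨(γ.ne_zero_iff z).1 hz, (proj_eq_iff γ).2 ⟨1, by rw [zpow_one]; rfl⟩⟩
    obtain ⟨φ, hφ, hxφ, -⟩ := exists_chart_target γ hx
    obtain ⟨ψ, hψ, hxψ, -⟩ := exists_chart_target γ (hproj x hx).1
    rw [hΓ _ ψ hψ hxψ, hΓ x φ hφ hxφ]
    exact christoffel_chart_transition nabla hφ hψ γ.contDiff_toFun hproj hxφ hxψ u v

end HopfManifold

/-! ### Extension of the connection to the origin -/

section Density

variable {E : Type*} [NormedAddCommGroup E] [NormedSpace ℂ E] [Nontrivial E]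
  {Γ : E → E →L[ℂ] E →L[ℂ] E} {f : E → E}

theorem eq_of_forall_ne_zero {F : Type*} [TopologicalSpace F] [T2Space F] {f g : E → F}
    (hf : Continuous f) (hg : Continuous g) (h : ∀ x ≠ 0, f x = g x) (x : E) : f x = g x := by
  have : (𝓝[≠] (0 : E)).NeBot := Module.punctured_nhds_neBot ℂ E 0
  exact congrFun (hf.ext_on (dense_compl_singleton (0 : E)) hg h) x

theorem symm_of_forall_ne_zero (hΓ : ContDiff ℂ 1 Γ) (h : ∀ x ≠ 0, ∀ u v, Γ x u v = Γ x v u)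
    (x u v : E) : Γ x u v = Γ x v u := by
  have := hΓ.continuous
  exact eq_of_forall_ne_zero (f := fun x => Γ x u v) (g := fun x => Γ x v u)
    (by fun_prop) (by fun_prop) (fun x hx => h x hx u v) x

set_option synthInstance.maxHeartbeats 200000 in
theorem flat_of_forall_ne_zero (hΓ : ContDiff ℂ 1 Γ)
    (h : ∀ x ≠ 0, ∀ u v w, fderiv ℂ Γ x u v w - fderiv ℂ Γ x v u w +
      Γ x u (Γ x v w) - Γ x v (Γ x u w) = 0) (x u v w : E) :
    fderiv ℂ Γ x u v w - fderiv ℂ Γ x v u w + Γ x u (Γ x v w) - Γ x v (Γ x u w) = 0 := by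
  have h1 := hΓ.continuous
  have h2 := hΓ.continuous_fderiv (by simp)
  exact eq_of_forall_ne_zero (f := fun x => fderiv ℂ Γ x u v w - fderiv ℂ Γ x v u w +
    Γ x u (Γ x v w) - Γ x v (Γ x u w)) (g := fun _ => 0)
    (by fun_prop) (by fun_prop) (fun x hx => h x hx u v w) x

theorem invariant_of_forall_ne_zero (hΓ : ContDiff ℂ 1 Γ) (hf : ContDiff ℂ 2 f)
    (h : ∀ x ≠ 0, ∀ u v, Γ (f x) (fderiv ℂ f x u) (fderiv ℂ f x v) +
      fderiv ℂ (fderiv ℂ f) x u v = fderiv ℂ f x (Γ x u v)) (x u v : E) :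
    Γ (f x) (fderiv ℂ f x u) (fderiv ℂ f x v) +
      fderiv ℂ (fderiv ℂ f) x u v = fderiv ℂ f x (Γ x u v) := by
  have h1 := hΓ.continuous
  have h2 := hf.continuous
  have h3 := hf.continuous_fderiv (by simp)
  have h4 := (hf.fderiv_right (m := 1) (by norm_num)).continuous_fderiv (by simp)
  exact eq_of_forall_ne_zero (f := fun x => Γ (f x) (fderiv ℂ f x u) (fderiv ℂ f x v) +
    fderiv ℂ (fderiv ℂ f) x u v) (g := fun x => fderiv ℂ f x (Γ x u v))
    (by fun_prop) (by fun_prop) (fun x hx => h x hx u v) x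

end Density

namespace HopfManifold

-- Hartogs applied to `Γ` with values in bilinear maps. The three identities are closed conditions
-- on the extension and its derivatives, so they pass to the origin by density of its complement.
set_option synthInstance.maxHeartbeats 200000 in
theorem exists_entire_christoffel_symbols {m : ℕ} {γ : HolomorphicContraction (m + 2)}
    (nabla : CovariantDerivative 𝓘(ℝ, Fin (m + 2) → ℂ) (Fin (m + 2) → ℂ)
      (fun x : HopfManifold γ => TangentSpace 𝓘(ℝ, Fin (m + 2) → ℂ) x))
    (hsmooth : nabla.ContMDiffCovariantDerivative ∞)
    (htorsion : nabla.torsion = 0) (hflat : nabla.IsFlat)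
    (hcompat : nabla.IsCompatibleWithHolomorphicStructure) :
    ∃ Γ : (Fin (m + 2) → ℂ) → (Fin (m + 2) → ℂ) →L[ℂ] (Fin (m + 2) → ℂ) →L[ℂ] (Fin (m + 2) → ℂ),
      Differentiable ℂ Γ ∧
      (∀ x u v, Γ x u v = Γ x v u) ∧
      (∀ x u v w, fderiv ℂ Γ x u v w - fderiv ℂ Γ x v u w +
        Γ x u (Γ x v w) - Γ x v (Γ x u w) = 0) ∧
      (∀ x u v, Γ (γ.toFun x) (fderiv ℂ γ.toFun x u) (fderiv ℂ γ.toFun x v) +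
        fderiv ℂ (fderiv ℂ γ.toFun) x u v = fderiv ℂ γ.toFun x (Γ x u v)) := by
  obtain ⟨Γ₀, hd, hsymm, hcurv, hinv⟩ :=
    exists_christoffel_symbols nabla hsmooth htorsion hflat hcompat
  obtain ⟨Γ, hΓ, hΓ₀⟩ := exists_differentiable_extension_of_differentiableOn_compl_zero
    (n := m) (E := (Fin (m + 2) → ℂ) →L[ℂ] (Fin (m + 2) → ℂ) →L[ℂ] (Fin (m + 2) → ℂ)) hd
  have hcd : ContDiff ℂ 1 Γ := hΓ.contDiff_pi.of_le (by simp)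
  have hfd {x : Fin (m + 2) → ℂ} (hx : x ≠ 0) : fderiv ℂ Γ x = fderiv ℂ Γ₀ x := by
    refine Filter.EventuallyEq.fderiv_eq ?_
    filter_upwards [isOpen_compl_singleton.mem_nhds hx] with y hy
    exact hΓ₀ y hy
  refine ⟨Γ, hΓ, symm_of_forall_ne_zero hcd fun x hx u v => ?_,
    flat_of_forall_ne_zero hcd fun x hx u v w => ?_,
    invariant_of_forall_ne_zero hcd (γ.contDiff_toFun.of_le (by simp)) fun x hx u v => ?_⟩
  · rw [hΓ₀ x hx, hsymm x hx]
  · rw [hfd hx, hΓ₀ x hx, hcurv x hx]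
  · rw [hΓ₀ x hx, hΓ₀ (γ.toFun x) ((γ.ne_zero_iff x).1 hx), hinv x hx]

end HopfManifold

theorem mainTheorem3 (n : ℕ) (γ : HolomorphicContraction n)
    (nabla : CovariantDerivative 𝓘(ℝ, Fin n → ℂ) (Fin n → ℂ)
      (fun x : HopfManifold γ => TangentSpace 𝓘(ℝ, Fin n → ℂ) x))
    (hsmooth : nabla.ContMDiffCovariantDerivative ∞)
    (htorsion : nabla.torsion = 0)
    (hflat : nabla.IsFlat)
    (hcompat : nabla.IsCompatibleWithHolomorphicStructure) :
    ∃ (A : GL (Fin n) ℂ) (δ : HolomorphicContraction n),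
      (∀ z : Fin n → ℂ, δ.toFun z = (A : Matrix (Fin n) (Fin n) ℂ).mulVec z) ∧
      Nonempty (HopfManifold γ ≃ₘ^ω⟮𝓘(ℂ, Fin n → ℂ), 𝓘(ℂ, Fin n → ℂ)⟯ HopfManifold δ) := by
  -- The extension across the origin requires at least two variables; below that `γ` is linear and
  -- `δ = γ`.
  rcases Nat.lt_or_ge n 2 with hn | hn
  · obtain ⟨A, hA⟩ := HolomorphicContraction.exists_generalLinearGroup_of_le_one
      (Nat.lt_succ_iff.1 hn) γ
    exact ⟨A, γ, hA, ⟨Diffeomorph.refl _ _ _⟩⟩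
  obtain ⟨m, rfl⟩ := Nat.exists_eq_add_of_le' hn
  obtain ⟨Γ, hΓ, hsymm, hcurv, hinv⟩ := HopfManifold.exists_entire_christoffel_symbols nabla
    hsmooth htorsion hflat hcompat
  obtain ⟨F, hF0, hF, hF', hFγ⟩ :=
    HolomorphicContraction.exists_local_linearization γ hΓ hsymm hcurv hinv
  obtain ⟨A, δ, Φ, hA, hΦ, hΦ', h0, hΦγ⟩ :=
    HolomorphicContraction.exists_global_linearization γ hF0 hF hF' hFγ
  exact ⟨A, δ, hA, HopfManifold.nonempty_diffeomorph Φ hΦ hΦ' h0 hΦγ⟩
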